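/- Let $G=(V,E)$ be a triconnected (3-connected) graph and let $\Gamma$ be a planar straight-line drawing of $G$ in the plane, with vertex positions $\gamma_i$ ($i\in V$), that is convex, i.e. every face (including the outer one) is bounded by a cycle of $G$ drawn as a convex polygon. A vertex is *external* if it lies on the boundary of the outer face and *internal* otherwise; an edge or a face is *strictly internal* if every vertex incident to it is internal. For each internal vertex $i$ and each neighbour $j\in N(i)$ let $z_{ij}\ge 0$ be a real weight ($z_{ij}$ and $z_{ji}$ may differ) such that $$\sum_{j\in N(i)} z_{ij}=1\quad\text{and}\quad \gamma_i=\sum_{j\in N(i)} z_{ij}\,\gamma_j ,$$ and suppose that $z_{ij}>0$ and $z_{ji}>0$ for each strictly internal edge $(i,j)$. Consider the homogeneous linear system with one real unknown $s_i$ for each internal vertex $i$ and the equation $$s_i z_{ij}-s_j z_{ji}=0$$ for each strictly internal edge $(i,j)$. This system has a nontrivial solution (one in which not every $s_i$ is $0$) if and only if for each strictly internal face, with boundary cycle $C=(v_0,v_1,\ldots,v_{k-1},v_k=v_0)$, $$\prod_{i=0}^{k-1} z_{v_i,v_{i+1}}=\prod_{i=1}^{k} z_{v_i,v_{i-1}}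 .$$ -/

import Mathlib

/-- The Euclidean plane. -/
abbrev Plane : Type := EuclideanSpace ℝ (Fin 2)

namespace BaryDrawing

variable {V : Type*}

/-- A graph is triconnected (3-connected) if it has at least four vertices and it stays connected
after the deletion of any set of at most two vertices. -/
def Triconnected (G : SimpleGraph V) : Prop :=
  4 ≤ Nat.card V ∧ ∀ S : Set V, S.Finite → S.ncard ≤ 2 → (G.induce Sᶜ).Connected

/-- The point set of the straight-line drawing of `G` with vertex positions `γ`: the positions of
the vertices and the segments that represent the edges. -/
def drawing (G : SimpleGraph V) (γ : V → Plane) : Set Plane :=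
  Set.range γ ∪ {p | ∃ u v, G.Adj u v ∧ p ∈ segment ℝ (γ u) (γ v)}

/-- The straight-line drawing of `G` with vertex positions `γ` is planar: distinct vertices have
distinct positions, an edge passes through no vertex other than its endpoints, and the relative
interiors of distinct edges are disjoint. -/
structure IsPlanarDrawing (G : SimpleGraph V) (γ : V → Plane) : Prop where
  injective : Function.Injective γ
  vertex_edge : ∀ u v w, G.Adj u v → γ w ∈ segment ℝ (γ u) (γ v) → w = u ∨ w = v
  edge_edge : ∀ u v x y, G.Adj u v → G.Adj x y → s(u, v) ≠ s(x, y) →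
    Disjoint (openSegment ℝ (γ u) (γ v)) (openSegment ℝ (γ x) (γ y))

/-- The faces of the drawing: the connected components of the complement of its point set. -/
def IsFace (G : SimpleGraph V) (γ : V → Plane) (F : Set Plane) : Prop :=
  ∃ p ∈ (drawing G γ)ᶜ, F = connectedComponentIn (drawing G γ)ᶜ p

/-- The outer face: the unbounded one. -/
def IsOuterFace (G : SimpleGraph V) (γ : V → Plane) (F : Set Plane) : Prop :=
  IsFace G γ F ∧ ¬ Bornology.IsBounded F

/-- The point set of the drawing of a walk: the union of the segments of its edges. -/
def trace {G : SimpleGraph V} (γ : V → Plane) {u v : V} (C : G.Walk u v) : Set Plane :=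
  {p | ∃ d ∈ C.darts, p ∈ segment ℝ (γ d.fst) (γ d.snd)}

/-- The closed walk `C = (v₀, v₁, …, v_k = v₀)` is a cycle of `G` that traverses the boundary of
the face `F` (in one of the two directions, from an arbitrary starting vertex). -/
def IsFacialCycle {G : SimpleGraph V} (γ : V → Plane) (F : Set Plane) {v : V}
    (C : G.Walk v v) : Prop :=
  IsFace G γ F ∧ C.IsCycle ∧ trace γ C = frontier F

/-- A planar straight-line drawing is convex if every face is a convex polygon: it is bounded by a
cycle of `G`, and the region that this cycle encloses is convex. That region is the face itself
for a bounded face, and the complement of the face for the outer face. -/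
structure IsConvexDrawing (G : SimpleGraph V) (γ : V → Plane) : Prop extends
    IsPlanarDrawing G γ where
  exists_facialCycle : ∀ F, IsFace G γ F → ∃ (v : V) (C : G.Walk v v), IsFacialCycle γ F C
  convex_of_bounded : ∀ F, IsFace G γ F → Bornology.IsBounded F → Convex ℝ F
  convex_compl_outer : ∀ F, IsOuterFace G γ F → Convex ℝ Fᶜ

/-- A vertex is external if it lies on the boundary of the outer face. -/
def IsExternal (G : SimpleGraph V) (γ : V → Plane) (v : V) : Prop :=
  ∃ F, IsOuterFace G γ F ∧ γ v ∈ frontier F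

/-- A vertex is internal if it is not external. -/
def IsInternal (G : SimpleGraph V) (γ : V → Plane) (v : V) : Prop :=
  ¬ IsExternal G γ v

/-- `(i, j)` is a strictly internal edge: an edge both of whose endpoints are internal. -/
def IsStrictlyInternalEdge (G : SimpleGraph V) (γ : V → Plane) (i j : V) : Prop :=
  G.Adj i j ∧ IsInternal G γ i ∧ IsInternal G γ j

/-- A face is strictly internal if every vertex incident to it is internal. -/
def IsStrictlyInternalFace (G : SimpleGraph V) (γ : V → Plane) (F : Set Plane) : Prop :=
  IsFace G γ F ∧ ∀ v, γ v ∈ frontier F → IsInternal G γ v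

/-- Directed barycentric weights for the drawing: `z i j` is the weight of the directed edge
`(i, j)`. The values `z i j` for `i` external or `j` not a neighbour of `i` are irrelevant. -/
structure IsBarycentricWeights [Fintype V] (G : SimpleGraph V) [DecidableRel G.Adj]
    (γ : V → Plane) (z : V → V → ℝ) : Prop where
  nonneg : ∀ i j, IsInternal G γ i → G.Adj i j → 0 ≤ z i j
  pos : ∀ i j, IsStrictlyInternalEdge G γ i j → 0 < z i j
  sum_eq_one : ∀ i, IsInternal G γ i → ∑ j ∈ G.neighborFinset i, z i j = 1
  barycenter : ∀ i, IsInternal G γ i → γ i = ∑ j ∈ G.neighborFinset i, z i j • γ j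

/-- `s`, one real unknown for each internal vertex, solves the scale-factor equations
`s i * z i j - s j * z j i = 0`, one for each strictly internal edge `(i, j)`. -/
def IsScaleSolution (G : SimpleGraph V) (γ : V → Plane) (z : V → V → ℝ)
    (s : {v : V // IsInternal G γ v} → ℝ) : Prop :=
  ∀ i j : {v : V // IsInternal G γ v}, G.Adj i j → s i * z i j - s j * z j i = 0

/-- Along `C = (v₀, …, v_k)` the product of the `z v_i v_{i+1}` equals the product of the
`z v_{i+1} v_i`. -/
def CycleProductEq {G : SimpleGraph V} (z : V → V → ℝ) {u v : V} (C : G.Walk u v) : Prop :=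
  (C.darts.map fun d => z d.fst d.snd).prod = (C.darts.map fun d => z d.snd d.fst).prod

end BaryDrawing

/-! The equation of an edge forces `s j = s i * z i j / z j i`, so a solution is propagated along
walks and is consistent exactly when the ratios multiply to 1 around closed walks through internal
vertices. With logarithms, `σ a b = log (z a b) - log (z b a)` is antisymmetric, and the question is
whether its sums around closed walks vanish as soon as they vanish around strictly internal faces.
Two facts of plane topology are needed; both are obtained from winding numbers, defined as sums of
viewing angles (`wind`).

One is a discrete Stokes formula. The winding number of a closed walk `K` jumps by 2π times the net
number of traversals when a dart is crossed, so the sum of `σ` over `K` is a sum over all darts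
weighted by the winding number to their left (`two_pi_mul_sum_darts`). Grouped by faces, a strictly
internal face contributes a multiple of its boundary sum, which is zero. Any other face touches an
external vertex, which `K` avoids and does not wind around, so its weight is zero
(`sum_darts_eq_zero_of_faces`).

The other is that the internal vertices exist and induce a connected subgraph (`exists_isInternal`,
`exists_internal_walk`). Otherwise winding numbers exhibit a union of regions of the drawing whose
only contacts with the rest are two vertices, against triconnectivity. Connectedness makes a
nontrivial solution nowhere zero, and lets a solution be built by exponentiating sums of `σ` along
walks from a root. -/

open Filter Topology

namespace BaryDrawing

/-! ### Viewing angles of a segment -/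

/-- The identification of the plane with the complex numbers. -/
noncomputable def cx : Plane ≃ₗᵢ[ℝ] ℂ := Complex.orthonormalBasisOneI.repr.symm

/-- The angle in `(-π, π]` under which the oriented segment from `a` to `b` is seen from `p`. -/
noncomputable def ang (a b p : Plane) : ℝ := ((cx b - cx p) / (cx a - cx p)).arg

lemma cx_sub_ne_zero {a p : Plane} (h : p ≠ a) : cx a - cx p ≠ 0 :=
  sub_ne_zero.2 fun e => h (cx.injective e).symm

lemma div_mem_slitPlane {a b p : Plane} (h : p ∉ segment ℝ a b) :
    (cx b - cx p) / (cx a - cx p) ∈ Complex.slitPlane := by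
  have ha : p ≠ a := fun e => h (e ▸ left_mem_segment ℝ p b)
  have ha' := cx_sub_ne_zero ha
  rw [Complex.mem_slitPlane_iff_not_le_zero]
  intro hle
  obtain ⟨t, ht, hte⟩ : ∃ t : ℝ, 0 ≤ t ∧ (cx b - cx p) / (cx a - cx p) = -(t : ℂ) := by
    refine ⟨-((cx b - cx p) / (cx a - cx p)).re, ?_, ?_⟩
    · have := (Complex.le_def.1 hle).1
      simp only [Complex.zero_re] at this
      linarith
    · have := (Complex.le_def.1 hle).2
      apply Complex.ext <;> simp_all
  rw [div_eq_iff ha'] at hte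
  apply h
  have h1 : (1 + t) ≠ 0 := by positivity
  -- The weights come from solving `b - p = -t (a - p)` for `p`.
  refine ⟨t / (1 + t), 1 / (1 + t), by positivity, by positivity, by field_simp; ring, ?_⟩
  apply cx.injective
  have h2 : (1 + (t : ℂ)) ≠ 0 := by exact_mod_cast h1
  simp only [map_add, map_smul, Complex.real_smul]
  push_cast
  field_simp
  linear_combination hte

lemma ang_comm {a b p : Plane} (h : p ∉ segment ℝ a b) : ang b a p = -ang a b p := by
  have := Complex.mem_slitPlane_iff_arg.1 (div_mem_slitPlane h)
  rw [ang, ← inv_div, Complex.arg_inv, if_neg this.1, ang]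

lemma continuousAt_ang {a b p : Plane} (h : p ∉ segment ℝ a b) : ContinuousAt (ang a b) p := by
  have ha : p ≠ a := fun e => h (e ▸ left_mem_segment ℝ p b)
  have hd : ContinuousAt (fun p => (cx b - cx p) / (cx a - cx p)) p :=
    ContinuousAt.div (by fun_prop) (by fun_prop) (cx_sub_ne_zero ha)
  exact (Complex.continuousAt_arg (div_mem_slitPlane h)).comp_of_eq hd rfl

lemma tendsto_ang_cobounded (a b : Plane) : Tendsto (ang a b) (Bornology.cobounded Plane) (𝓝 0) := by
  have h1 : Tendsto (fun p => cx a - cx p) (Bornology.cobounded Plane) (Bornology.cobounded ℂ) := by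
    rw [← tendsto_norm_atTop_iff_cobounded]
    refine tendsto_atTop_mono (f := fun p : Plane => ‖p‖ - ‖cx a‖) (fun p => ?_) ?_
    · have := norm_sub_norm_le (cx p) (cx a)
      rw [norm_sub_rev, cx.norm_map p] at this
      exact this
    · exact tendsto_atTop_add_const_right _ _ tendsto_norm_cobounded_atTop
  have h2 : Tendsto (fun p => 1 + (cx b - cx a) * (cx a - cx p)⁻¹) (Bornology.cobounded Plane)
      (𝓝 (1 + (cx b - cx a) * 0)) :=
    tendsto_const_nhds.add (tendsto_const_nhds.mul (tendsto_inv₀_cobounded.comp h1))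
  have h3 : Tendsto (fun p => (cx b - cx p) / (cx a - cx p)) (Bornology.cobounded Plane) (𝓝 1) := by
    rw [mul_zero, add_zero] at h2
    refine h2.congr' ?_
    have : ∀ᶠ p in Bornology.cobounded Plane, p ≠ a :=
      Bornology.eventually_ne_cobounded a
    filter_upwards [this] with p hp
    have := cx_sub_ne_zero hp
    field_simp
    ring
  have := (Complex.continuousAt_arg (x := 1) (by simp)).tendsto.comp h3
  rw [Complex.arg_one] at this
  exact this

/-- The vector from the midpoint of `a` and `b`, orthogonal to the segment on its left side. -/
noncomputable def leftNormal (a b : Plane) : Plane := cx.symm (Complex.I * ((cx b - cx a) / 2))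

lemma cx_midpoint (a b : Plane) : cx (midpoint ℝ a b) = (cx a + cx b) / 2 := by
  rw [midpoint_eq_smul_add]
  simp [Complex.real_smul]
  ring

/-- The ratio is `-(1 - it)/(1 + it)`, a point of the unit circle. As `t` decreases to 0 it tends to
-1 from the upper half-plane, which gives the one-sided limit π of the angle. -/
lemma ang_shift {a b : Plane} (hab : a ≠ b) (t : ℝ) :
    ang a b (midpoint ℝ a b + t • leftNormal a b)
      = (((t ^ 2 - 1 : ℝ) : ℂ) / (t ^ 2 + 1 : ℝ) + ((2 * t / (t ^ 2 + 1) : ℝ) : ℂ) * Complex.I).arg := by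
  rw [ang]
  congr 1
  have h : cx b - cx a ≠ 0 := cx_sub_ne_zero hab
  have e : ∀ t : ℝ, (1 + Complex.I * t) ≠ 0 := fun t e => by
    have := congrArg Complex.re e
    simp at this
  have h2 : (t : ℂ) ^ 2 + 1 ≠ 0 := by
    have : (t ^ 2 + 1 : ℝ) ≠ 0 := by positivity
    exact_mod_cast this
  have e1 : cx b - cx (midpoint ℝ a b + t • leftNormal a b)
      = (cx b - cx a) / 2 * (1 + Complex.I * (-t : ℝ)) := by
    simp only [map_add, map_smul, cx_midpoint, leftNormal, LinearIsometryEquiv.apply_symm_apply,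
      Complex.real_smul]
    push_cast
    ring
  have e2 : cx a - cx (midpoint ℝ a b + t • leftNormal a b)
      = -((cx b - cx a) / 2 * (1 + Complex.I * t)) := by
    simp only [map_add, map_smul, cx_midpoint, leftNormal, LinearIsometryEquiv.apply_symm_apply,
      Complex.real_smul]
    ring
  rw [e1, e2, div_eq_iff (neg_ne_zero.2 (mul_ne_zero (div_ne_zero h two_ne_zero) (e t)))]
  push_cast
  field_simp
  linear_combination (2 * (t : ℂ) ^ 2) * Complex.I_sq

lemma tendsto_ang_left {a b : Plane} (hab : a ≠ b) :
    Tendsto (fun t : ℝ => ang a b (midpoint ℝ a b + t • leftNormal a b)) (𝓝[>] 0) (𝓝 Real.pi) := by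
  simp_rw [ang_shift hab]
  have h := Complex.tendsto_arg_nhdsWithin_im_nonneg_of_re_neg_of_im_zero (z := -1) (by simp) (by simp)
  refine h.comp (tendsto_nhdsWithin_iff.2 ⟨?_, ?_⟩)
  · have : ContinuousAt (fun t : ℝ => (((t ^ 2 - 1 : ℝ) : ℂ) / (t ^ 2 + 1 : ℝ)
        + ((2 * t / (t ^ 2 + 1) : ℝ) : ℂ) * Complex.I)) 0 := by
      have h2 : ContinuousAt (fun t : ℝ => (2 * t / (t ^ 2 + 1) : ℝ)) 0 :=
        ContinuousAt.div (by fun_prop) (by fun_prop) (by norm_num)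
      refine ContinuousAt.add (ContinuousAt.div (by fun_prop) (by fun_prop) (by norm_num)) ?_
      exact (Complex.continuous_ofReal.continuousAt.comp h2).mul continuousAt_const
    have := this.tendsto
    simp only [ne_eq, OfNat.ofNat_ne_zero, not_false_eq_true, zero_pow, zero_sub, zero_add,
      mul_zero, Complex.ofReal_zero, zero_mul, add_zero, Complex.ofReal_neg,
      Complex.ofReal_one, div_one] at this
    exact this.mono_left nhdsWithin_le_nhds
  · filter_upwards [self_mem_nhdsWithin] with t ht
    have : 0 ≤ 2 * t / (t ^ 2 + 1) := by
      have : (0 : ℝ) < t := ht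
      positivity
    change 0 ≤ Complex.im _
    rw [← Complex.ofReal_div, Complex.add_im, Complex.ofReal_im,
      Complex.im_ofReal_mul, Complex.I_im]
    simpa using this

lemma midpoint_add_notMem_segment {a b : Plane} (hab : a ≠ b) {t : ℝ} (ht : t ≠ 0) :
    midpoint ℝ a b + t • leftNormal a b ∉ segment ℝ a b := by
  rintro ⟨x, y, hx, hy, hxy, e⟩
  have e' := congrArg cx e
  simp only [map_add, map_smul, cx_midpoint, leftNormal, LinearIsometryEquiv.apply_symm_apply,
      Complex.real_smul] at e'
  have h : cx b - cx a ≠ 0 := cx_sub_ne_zero hab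
  have hx' : (x : ℂ) = 1 - y := by rw [← Complex.ofReal_one, ← hxy]; push_cast; ring
  rw [hx'] at e'
  have e2 : (cx b - cx a) * ((y : ℂ) - 1 / 2 - Complex.I * t / 2) = 0 := by
    linear_combination e'
  rcases mul_eq_zero.1 e2 with h0 | h0
  · exact h h0
  · have := congrArg Complex.im h0
    simp at this
    exact ht this

lemma tendsto_ang_right {a b : Plane} (hab : a ≠ b) :
    Tendsto (fun t : ℝ => ang a b (midpoint ℝ a b + t • leftNormal b a)) (𝓝[>] 0)
      (𝓝 (-Real.pi)) := by
  refine ((tendsto_ang_left hab.symm).neg).congr' ?_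
  filter_upwards [self_mem_nhdsWithin] with t ht
  rw [midpoint_comm]
  refine (ang_comm ?_).symm
  rw [midpoint_comm]
  exact midpoint_add_notMem_segment hab.symm (ne_of_gt ht)

variable {V : Type*} {G : SimpleGraph V} {γ : V → Plane}

/-! ### Winding numbers of closed walks -/

/-- The total angle under which the drawing of the walk `q` is seen from `p`. -/
noncomputable def wind (γ : V → Plane) {u v : V} (q : G.Walk u v) (p : Plane) : ℝ :=
  (q.darts.map fun d => ang (γ d.fst) (γ d.snd) p).sum

@[simp] lemma wind_nil (u : V) (p : Plane) : wind γ (SimpleGraph.Walk.nil : G.Walk u u) p = 0 := by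
  simp [wind]

@[simp] lemma wind_cons {u v w : V} (h : G.Adj u v) (q : G.Walk v w) (p : Plane) :
    wind γ (SimpleGraph.Walk.cons h q) p = ang (γ u) (γ v) p + wind γ q p := by
  simp [wind]

lemma wind_append {u v w : V} (q : G.Walk u v) (r : G.Walk v w) (p : Plane) :
    wind γ (q.append r) p = wind γ q p + wind γ r p := by
  simp [wind, SimpleGraph.Walk.darts_append]

lemma wind_congr_perm {u v x y : V} {q : G.Walk u v} {r : G.Walk x y}
    (h : q.darts.Perm r.darts) (p : Plane) : wind γ q p = wind γ r p :=
  (h.map _).sum_eq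

lemma trace_congr_perm {u v x y : V} {q : G.Walk u v} {r : G.Walk x y}
    (h : q.darts.Perm r.darts) : trace γ q = trace γ r := by
  ext p
  simp [trace, h.mem_iff]

@[simp] lemma trace_nil (u : V) : trace γ (SimpleGraph.Walk.nil : G.Walk u u) = ∅ := by
  simp [trace]

@[simp] lemma trace_cons {u v w : V} (h : G.Adj u v) (q : G.Walk v w) :
    trace γ (SimpleGraph.Walk.cons h q) = segment ℝ (γ u) (γ v) ∪ trace γ q := by
  ext p
  simp [trace]

lemma trace_append {u v w : V} (q : G.Walk u v) (r : G.Walk v w) :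
    trace γ (q.append r) = trace γ q ∪ trace γ r := by
  ext p
  simp [trace, SimpleGraph.Walk.darts_append, or_and_right, exists_or]

lemma wind_reverse {u v : V} (q : G.Walk u v) {p : Plane} (hp : p ∉ trace γ q) :
    wind γ q.reverse p = -wind γ q p := by
  induction q with
  | nil => simp
  | cons h q ih =>
    rw [trace_cons, Set.mem_union, not_or] at hp
    rw [SimpleGraph.Walk.reverse_cons, wind_append, ih hp.2, wind_cons, wind_cons, wind_nil,
      ang_comm hp.1]
    ring

lemma trace_subset_drawing {u v : V} (q : G.Walk u v) : trace γ q ⊆ drawing G γ := by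
  rintro p ⟨d, -, hp⟩
  exact Or.inr ⟨d.fst, d.snd, d.adj, hp⟩

lemma isClosed_segment (a b : Plane) : IsClosed (segment ℝ a b) := by
  rw [← convexHull_pair]
  exact ((Set.toFinite {a, b}).isCompact_convexHull (𝕜 := ℝ)).isClosed

lemma continuousAt_wind {u v : V} (q : G.Walk u v) {p : Plane} (hp : p ∉ trace γ q) :
    ContinuousAt (wind γ q) p := by
  induction q with
  | @nil u =>
    have : wind γ (SimpleGraph.Walk.nil : G.Walk u u) = fun _ => 0 := funext fun p => wind_nil _ p
    rw [this]
    exact continuousAt_const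
  | @cons u v w h q ih =>
    rw [trace_cons, Set.mem_union, not_or] at hp
    have : wind γ (SimpleGraph.Walk.cons h q) = fun p => ang (γ u) (γ v) p + wind γ q p :=
      funext fun p => wind_cons h q p
    rw [this]
    exact (continuousAt_ang hp.1).add (ih hp.2)

lemma tendsto_wind_cobounded {u v : V} (q : G.Walk u v) :
    Tendsto (wind γ q) (Bornology.cobounded Plane) (𝓝 0) := by
  induction q with
  | @nil u =>
    have : wind γ (SimpleGraph.Walk.nil : G.Walk u u) = fun _ => 0 := funext fun p => wind_nil _ p
    rw [this]
    exact tendsto_const_nhds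
  | @cons u v w h q ih =>
    have : wind γ (SimpleGraph.Walk.cons h q) = fun p => ang (γ u) (γ v) p + wind γ q p :=
      funext fun p => wind_cons h q p
    rw [this]
    simpa using (tendsto_ang_cobounded _ _).add ih

/-- Each edge rotates the direction seen from `p` by its angle. The moduli are multiplied across,
and for a closed walk the identity reduces to `exp (i * wind) = 1`. -/
lemma exp_wind {u v : V} (q : G.Walk u v) {p : Plane} (hp : p ∉ trace γ q) (hu : p ≠ γ u) :
    (‖cx (γ u) - cx p‖ : ℂ) * (cx (γ v) - cx p)
      = ‖cx (γ v) - cx p‖ * (cx (γ u) - cx p) * Complex.exp (wind γ q p * Complex.I) := by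
  induction q with
  | nil => simp
  | @cons u v w h q ih =>
    rw [trace_cons, Set.mem_union, not_or] at hp
    have hv : p ≠ γ v := fun e => hp.1 (e ▸ right_mem_segment ℝ _ _)
    have ih := ih hp.2 hv
    have hu' := cx_sub_ne_zero hu
    have hv' := cx_sub_ne_zero hv
    have e := Complex.norm_mul_exp_arg_mul_I ((cx (γ v) - cx p) / (cx (γ u) - cx p))
    change _ * Complex.exp (ang (γ u) (γ v) p * Complex.I) = _ at e
    rw [norm_div, Complex.ofReal_div] at e
    have n1 : (‖cx (γ u) - cx p‖ : ℂ) ≠ 0 := by exact_mod_cast norm_ne_zero_iff.2 hu'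
    have n2 : (‖cx (γ v) - cx p‖ : ℂ) ≠ 0 := by exact_mod_cast norm_ne_zero_iff.2 hv'
    rw [wind_cons, Complex.ofReal_add, add_mul, Complex.exp_add]
    field_simp at e
    apply mul_left_cancel₀ n2
    linear_combination (‖cx (γ u) - cx p‖ : ℂ) * ih - ‖cx (γ w) - cx p‖
      * Complex.exp (wind γ q p * Complex.I) * e

lemma exists_int_wind {v : V} (K : G.Walk v v) {p : Plane} (hp : p ∉ trace γ K) :
    ∃ n : ℤ, wind γ K p = n * (2 * Real.pi) := by
  by_cases hn : K.Nil
  · refine ⟨0, ?_⟩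
    rw [hn.eq_nil]
    simp
  · have hv : p ≠ γ v := by
      cases K with
      | nil => simp at hn
      | cons h q =>
        rintro rfl
        rw [trace_cons] at hp
        exact hp (Or.inl (left_mem_segment ℝ _ _))
    have hv' := cx_sub_ne_zero hv
    have n1 : (‖cx (γ v) - cx p‖ : ℂ) ≠ 0 := by exact_mod_cast norm_ne_zero_iff.2 hv'
    have e := exp_wind K hp hv
    have e1 : Complex.exp (wind γ K p * Complex.I) = 1 := by
      apply mul_left_cancel₀ (mul_ne_zero n1 hv')
      rw [← e, mul_one]
    obtain ⟨n, hn⟩ := Complex.exp_eq_one_iff.1 e1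
    refine ⟨n, ?_⟩
    have := congrArg Complex.im hn
    simpa using this

/-- Off the trace, `wind` is continuous with values in the discrete group 2πℤ. -/
lemma wind_eq_of_isPreconnected {v : V} (K : G.Walk v v) {s : Set Plane} (hs : IsPreconnected s)
    (hd : Disjoint s (trace γ K)) {x y : Plane} (hx : x ∈ s) (hy : y ∈ s) :
    wind γ K x = wind γ K y := by
  have hpi := Real.two_pi_pos
  have hmaps : Set.MapsTo (wind γ K) s (AddSubgroup.zmultiples (2 * Real.pi) : Set ℝ) := by
    intro p hp
    obtain ⟨n, hn⟩ := exists_int_wind K (hd.notMem_of_mem_left hp)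
    exact AddSubgroup.mem_zmultiples_iff.2 ⟨n, by rw [hn, zsmul_eq_mul]⟩
  have hc : ContinuousOn (wind γ K) s := fun p hp =>
    (continuousAt_wind K (hd.notMem_of_mem_left hp)).continuousWithinAt
  have : IsDiscrete (AddSubgroup.zmultiples (2 * Real.pi) : Set ℝ) :=
    isDiscrete_iff_discreteTopology.2
      (inferInstanceAs (DiscreteTopology (AddSubgroup.zmultiples (2 * Real.pi))))
  exact hs.constant_of_mapsTo this hc hmaps hx hy

lemma wind_eq_zero_of_unbounded {v : V} (K : G.Walk v v) {s : Set Plane} (hs : IsPreconnected s)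
    (hd : Disjoint s (trace γ K)) (hb : ¬ Bornology.IsBounded s) {x : Plane} (hx : x ∈ s) :
    wind γ K x = 0 := by
  have hpi := Real.two_pi_pos
  have h1 : ∀ᶠ p in Bornology.cobounded Plane, |wind γ K p| < 2 * Real.pi := by
    have := (tendsto_wind_cobounded (γ := γ) K).abs
    rw [abs_zero] at this
    exact this.eventually (gt_mem_nhds hpi)
  obtain ⟨p, hps, hp⟩ : ∃ p ∈ s, |wind γ K p| < 2 * Real.pi := by
    by_contra! hcon
    apply hb
    rw [Bornology.isBounded_def]
    filter_upwards [h1] with p hp hps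
    exact (hcon p hps).not_gt hp
  obtain ⟨n, hn⟩ := exists_int_wind K (hd.notMem_of_mem_left hps)
  rw [wind_eq_of_isPreconnected K hs hd hx hps, hn]
  rw [hn, abs_mul, abs_of_pos hpi] at hp
  have : |(n : ℝ)| < 1 := by nlinarith
  have : n = 0 := by
    rw [← Int.abs_lt_one_iff]
    exact_mod_cast this
  simp [this]

/-! ### Jump of the winding number across an edge -/

lemma mem_segment_cases {a b p : Plane} (h : p ∈ segment ℝ a b) :
    p = a ∨ p = b ∨ p ∈ openSegment ℝ a b := by
  rwa [← insert_endpoints_openSegment, Set.mem_insert_iff, Set.mem_insert_iff] at h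

lemma IsPlanarDrawing.exists_common_endpoint (hγ : IsPlanarDrawing G γ) {u v x y : V}
    (huv : G.Adj u v) (hxy : G.Adj x y) (hne : s(u, v) ≠ s(x, y)) {p : Plane}
    (hp : p ∈ segment ℝ (γ u) (γ v)) (hp' : p ∈ segment ℝ (γ x) (γ y)) :
    ∃ w, p = γ w ∧ (w = u ∨ w = v) ∧ (w = x ∨ w = y) := by
  rcases mem_segment_cases hp with rfl | rfl | h
  · exact ⟨u, rfl, Or.inl rfl, hγ.vertex_edge _ _ _ hxy hp'⟩
  · exact ⟨v, rfl, Or.inr rfl, hγ.vertex_edge _ _ _ hxy hp'⟩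
  rcases mem_segment_cases hp' with rfl | rfl | h'
  · exact ⟨x, rfl, hγ.vertex_edge _ _ _ huv hp, Or.inl rfl⟩
  · exact ⟨y, rfl, hγ.vertex_edge _ _ _ huv hp, Or.inr rfl⟩
  exact ((hγ.edge_edge _ _ _ _ huv hxy hne).notMem_of_mem_left h h').elim

lemma IsPlanarDrawing.midpoint_ne (hγ : IsPlanarDrawing G γ) {u v : V} (huv : G.Adj u v) (w : V) :
    midpoint ℝ (γ u) (γ v) ≠ γ w := by
  intro e
  have hne := hγ.injective.ne huv.ne
  rcases hγ.vertex_edge u v w huv (e ▸ midpoint_mem_segment _ _) with rfl | rfl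
  · exact hne (midpoint_eq_left_iff ℝ |>.1 e)
  · exact hne (midpoint_eq_right_iff ℝ |>.1 e)

lemma IsPlanarDrawing.midpoint_notMem (hγ : IsPlanarDrawing G γ) {u v x y : V} (huv : G.Adj u v)
    (hxy : G.Adj x y) (hne : s(u, v) ≠ s(x, y)) :
    midpoint ℝ (γ u) (γ v) ∉ segment ℝ (γ x) (γ y) := by
  intro h
  obtain ⟨w, hw, -⟩ := hγ.exists_common_endpoint huv hxy hne (midpoint_mem_segment _ _) h
  exact hγ.midpoint_ne huv w hw

lemma IsPlanarDrawing.exists_shift [Finite V] (hγ : IsPlanarDrawing G γ) {u v : V}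
    (huv : G.Adj u v) :
    ∃ ε : ℝ, 0 < ε ∧ ∀ t ∈ Set.Ioc 0 ε,
      midpoint ℝ (γ u) (γ v) + t • leftNormal (γ u) (γ v) ∉ drawing G γ := by
  have hne := hγ.injective.ne huv.ne
  -- The edge `uv` is left out of `D`: the midpoint has a neighbourhood free of everything else, and
  -- a shifted point is off `uv` itself because it leaves its line.
  let E : Set (V × V) := {e | G.Adj e.1 e.2 ∧ s(u, v) ≠ s(e.1, e.2)}
  let D : Set Plane := Set.range γ ∪ ⋃ e ∈ E, segment ℝ (γ e.1) (γ e.2)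
  have hD : IsClosed D := (Set.finite_range γ).isClosed.union
    ((Set.toFinite E).isClosed_biUnion fun e _ => isClosed_segment _ _)
  have hm : midpoint ℝ (γ u) (γ v) ∉ D := by
    rintro (⟨w, hw⟩ | h)
    · exact hγ.midpoint_ne huv w hw.symm
    · obtain ⟨e, he, h⟩ := Set.mem_iUnion₂.1 h
      exact hγ.midpoint_notMem huv he.1 he.2 h
  have hc : Continuous fun t : ℝ => midpoint ℝ (γ u) (γ v) + t • leftNormal (γ u) (γ v) := by
    fun_prop
  have hev : ∀ᶠ t in 𝓝[>] (0 : ℝ),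
      midpoint ℝ (γ u) (γ v) + t • leftNormal (γ u) (γ v) ∈ Dᶜ := by
    refine nhdsWithin_le_nhds (hc.continuousAt.eventually_mem ?_)
    rw [zero_smul, add_zero]
    exact hD.isOpen_compl.mem_nhds hm
  obtain ⟨ε, hε, h⟩ := mem_nhdsGT_iff_exists_Ioc_subset.1 hev
  refine ⟨ε, hε, fun t ht hmem => ?_⟩
  have htD := h ht
  rcases hmem with hmem | ⟨x, y, hxy, hmem⟩
  · exact htD (Or.inl hmem)
  · by_cases hs : s(u, v) = s(x, y)
    · have : midpoint ℝ (γ u) (γ v) + t • leftNormal (γ u) (γ v) ∈ segment ℝ (γ u) (γ v) := by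
        rcases Sym2.eq_iff.1 hs with ⟨rfl, rfl⟩ | ⟨rfl, rfl⟩
        · exact hmem
        · rwa [segment_symm]
      exact midpoint_add_notMem_segment hne ht.1.ne' this
    · exact htD (Or.inr (Set.mem_iUnion₂.2 ⟨(x, y), ⟨hxy, hs⟩, hmem⟩))

/-- A point off the drawing, close to the midpoint of the dart `d` and to its left. -/
noncomputable def leftPoint [Finite V] (hγ : IsPlanarDrawing G γ) (d : G.Dart) : Plane :=
  midpoint ℝ (γ d.fst) (γ d.snd) + (hγ.exists_shift d.adj).choose • leftNormal (γ d.fst) (γ d.snd)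

lemma leftPoint_notMem [Finite V] (hγ : IsPlanarDrawing G γ) (d : G.Dart) :
    leftPoint hγ d ∉ drawing G γ :=
  have h := (hγ.exists_shift d.adj).choose_spec
  h.2 _ ⟨h.1, le_rfl⟩

lemma eventually_wind_eq_leftPoint [Finite V] (hγ : IsPlanarDrawing G γ) (d : G.Dart) {v : V}
    (K : G.Walk v v) : ∀ᶠ t in 𝓝[>] (0 : ℝ),
      wind γ K (midpoint ℝ (γ d.fst) (γ d.snd) + t • leftNormal (γ d.fst) (γ d.snd))
        = wind γ K (leftPoint hγ d) := by
  have h := (hγ.exists_shift d.adj).choose_spec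
  filter_upwards [Ioc_mem_nhdsGT h.1] with t ht
  let f : ℝ → Plane := fun t => midpoint ℝ (γ d.fst) (γ d.snd) + t • leftNormal (γ d.fst) (γ d.snd)
  have hf : Continuous f := by fun_prop
  have hs : IsPreconnected (f '' Set.Ioc 0 (hγ.exists_shift d.adj).choose) :=
    isPreconnected_Ioc.image f hf.continuousOn
  refine wind_eq_of_isPreconnected K hs ?_ (Set.mem_image_of_mem f ht)
    (Set.mem_image_of_mem f ⟨h.1, le_rfl⟩)
  rw [Set.disjoint_left]
  rintro _ ⟨t, ht, rfl⟩ hmem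
  exact h.2 t ht (trace_subset_drawing K hmem)

-- Only the terms of `d` and `d.symm` are discontinuous at the midpoint of `d`: for `d` the angle is
-- π on the left and -π on the right, and the reverse dart has the opposite jump.
open scoped Classical in
lemma tendsto_wind_sub (hγ : IsPlanarDrawing G γ) (d : G.Dart) {x y : V} (q : G.Walk x y) :
    Tendsto (fun t : ℝ =>
      wind γ q (midpoint ℝ (γ d.fst) (γ d.snd) + t • leftNormal (γ d.fst) (γ d.snd))
        - wind γ q (midpoint ℝ (γ d.fst) (γ d.snd) + t • leftNormal (γ d.snd) (γ d.fst)))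
      (𝓝[>] 0) (𝓝 (2 * Real.pi * (q.darts.count d - q.darts.count d.symm))) := by
  have hne := hγ.injective.ne d.adj.ne
  induction q with
  | nil => simp
  | @cons x y z h q ih =>
    simp only [wind_cons, SimpleGraph.Walk.darts_cons, List.count_cons]
    have key : Tendsto (fun t : ℝ =>
        ang (γ x) (γ y) (midpoint ℝ (γ d.fst) (γ d.snd) + t • leftNormal (γ d.fst) (γ d.snd))
        - ang (γ x) (γ y) (midpoint ℝ (γ d.fst) (γ d.snd) + t • leftNormal (γ d.snd) (γ d.fst)))
        (𝓝[>] 0) (𝓝 (2 * Real.pi * ((if (⟨(x, y), h⟩ : G.Dart) = d then 1 else 0)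
          - (if (⟨(x, y), h⟩ : G.Dart) = d.symm then 1 else 0)))) := by
      by_cases h1 : (⟨(x, y), h⟩ : G.Dart) = d
      · subst h1
        have h2 : (⟨(x, y), h⟩ : G.Dart) ≠ (⟨(x, y), h⟩ : G.Dart).symm :=
          (SimpleGraph.Dart.symm_ne _).symm
        rw [if_pos rfl, if_neg h2]
        have := (tendsto_ang_left hne).sub (tendsto_ang_right hne)
        convert this using 2
        ring
      by_cases h2 : (⟨(x, y), h⟩ : G.Dart) = d.symm
      · rw [if_neg h1, if_pos h2]
        have hx : x = d.snd := congrArg (fun e : G.Dart => e.fst) h2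
        have hy : y = d.fst := congrArg (fun e : G.Dart => e.snd) h2
        subst hx hy
        rw [midpoint_comm]
        have := (tendsto_ang_right hne.symm).sub (tendsto_ang_left hne.symm)
        convert this using 2
        ring
      rw [if_neg h1, if_neg h2]
      have h3 : s(d.fst, d.snd) ≠ s(x, y) := by
        intro e
        rcases Sym2.eq_iff.1 e with ⟨e1, e2⟩ | ⟨e1, e2⟩
        · exact h1 (by ext <;> simp [e1, e2])
        · exact h2 (by ext <;> simp [e1, e2])
      have hm := hγ.midpoint_notMem d.adj h h3
      have hc : ∀ n : Plane, Tendsto (fun t : ℝ =>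
          ang (γ x) (γ y) (midpoint ℝ (γ d.fst) (γ d.snd) + t • n)) (𝓝[>] 0)
          (𝓝 (ang (γ x) (γ y) (midpoint ℝ (γ d.fst) (γ d.snd)))) := by
        intro n
        have h0 : Continuous fun t : ℝ => midpoint ℝ (γ d.fst) (γ d.snd) + t • n := by fun_prop
        have h4 := h0.tendsto 0
        rw [zero_smul, add_zero] at h4
        exact ((continuousAt_ang hm).tendsto.comp h4).mono_left nhdsWithin_le_nhds
      have := (hc (leftNormal (γ d.fst) (γ d.snd))).sub (hc (leftNormal (γ d.snd) (γ d.fst)))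
      simpa using this
    convert key.add ih using 2
    · ring
    · push_cast
      simp only [beq_iff_eq]
      ring

open scoped Classical in
lemma wind_leftPoint_sub [Finite V] (hγ : IsPlanarDrawing G γ) (d : G.Dart) {v : V}
    (K : G.Walk v v) :
    wind γ K (leftPoint hγ d) - wind γ K (leftPoint hγ d.symm)
      = 2 * Real.pi * (K.darts.count d - K.darts.count d.symm) := by
  refine tendsto_nhds_unique (Tendsto.congr' ?_ tendsto_const_nhds) (tendsto_wind_sub hγ d K)
  filter_upwards [eventually_wind_eq_leftPoint hγ d K, eventually_wind_eq_leftPoint hγ d.symm K]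
    with t h1 h2
  rw [h1, ← h2]
  simp only [SimpleGraph.Dart.symm, Prod.fst_swap, Prod.snd_swap]
  rw [midpoint_comm]

/-! ### Discrete Stokes formula -/

lemma list_sum_map_eq_sum_count {α : Type*} [Fintype α] [DecidableEq α] (l : List α) (f : α → ℝ) :
    (l.map f).sum = ∑ a, (l.count a : ℝ) * f a := by
  induction l with
  | nil => simp
  | cons b l ih =>
    simp [ih, List.count_cons, add_mul, Finset.sum_add_distrib, add_comm]

/-- The sum of an antisymmetric function over a closed walk is the sum over all darts, weighted
by the winding numbers around the points to their left. -/
lemma two_pi_mul_sum_darts [Finite V] [Fintype G.Dart] (hγ : IsPlanarDrawing G γ) {v : V}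
    (K : G.Walk v v) {σ : V → V → ℝ} (hσ : ∀ a b, σ b a = -σ a b) :
    2 * Real.pi * (K.darts.map fun d => σ d.fst d.snd).sum
      = ∑ d : G.Dart, wind γ K (leftPoint hγ d) * σ d.fst d.snd := by
  classical
  have hinv : ∀ f : G.Dart → ℝ, ∑ d : G.Dart, f d.symm * σ d.fst d.snd
      = -∑ d : G.Dart, f d * σ d.fst d.snd := by
    intro f
    rw [← Finset.sum_neg_distrib]
    refine Fintype.sum_equiv (Function.Involutive.toPerm _ SimpleGraph.Dart.symm_involutive) _ _ ?_
    intro d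
    simp [hσ d.fst d.snd]
  -- The jumps weighted by `σ` are summed in two ways, from the winding numbers and from the
  -- traversal counts. Reversing darts flips the sign of `σ`, whence the factor 2 on both sides.
  have h1 : ∑ d : G.Dart, (wind γ K (leftPoint hγ d) - wind γ K (leftPoint hγ d.symm))
      * σ d.fst d.snd = 2 * ∑ d : G.Dart, wind γ K (leftPoint hγ d) * σ d.fst d.snd := by
    simp only [sub_mul, Finset.sum_sub_distrib]
    rw [hinv fun d => wind γ K (leftPoint hγ d)]
    ring
  have h2 : ∑ d : G.Dart, (wind γ K (leftPoint hγ d) - wind γ K (leftPoint hγ d.symm))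
      * σ d.fst d.snd = 2 * Real.pi * (2 * (K.darts.map fun d => σ d.fst d.snd).sum) := by
    simp only [wind_leftPoint_sub, mul_assoc, sub_mul]
    rw [← Finset.mul_sum, ← Finset.mul_sum, Finset.sum_sub_distrib,
      hinv fun d => (K.darts.count d : ℝ), list_sum_map_eq_sum_count]
    ring
  linarith

/-! ### Winding numbers on faces -/

lemma isFace_connectedComponentIn {p : Plane} (hp : p ∉ drawing G γ) :
    IsFace G γ (connectedComponentIn (drawing G γ)ᶜ p) :=
  ⟨p, hp, rfl⟩

lemma IsFace.isPreconnected {F : Set Plane} (hF : IsFace G γ F) : IsPreconnected F := by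
  obtain ⟨p, -, rfl⟩ := hF
  exact isPreconnected_connectedComponentIn

lemma IsFace.nonempty {F : Set Plane} (hF : IsFace G γ F) : F.Nonempty := by
  obtain ⟨p, hp, rfl⟩ := hF
  exact ⟨p, mem_connectedComponentIn hp⟩

lemma IsFace.disjoint_drawing {F : Set Plane} (hF : IsFace G γ F) : Disjoint F (drawing G γ) := by
  obtain ⟨p, -, rfl⟩ := hF
  exact Set.disjoint_left.2 fun x hx => connectedComponentIn_subset _ _ hx

lemma IsFace.disjoint_trace {F : Set Plane} (hF : IsFace G γ F) {u v : V} (q : G.Walk u v) :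
    Disjoint F (trace γ q) :=
  hF.disjoint_drawing.mono_right (trace_subset_drawing q)

lemma IsFace.eq_connectedComponentIn {F : Set Plane} (hF : IsFace G γ F) {p : Plane} (hp : p ∈ F) :
    F = connectedComponentIn (drawing G γ)ᶜ p := by
  obtain ⟨x, -, rfl⟩ := hF
  exact connectedComponentIn_eq hp

/-- A preconnected set stays so when a point of its closure is added. This carries winding numbers
from a face to a vertex on its frontier. -/
lemma wind_eq_of_mem_closure {v : V} (K : G.Walk v v) {s : Set Plane} (hs : IsPreconnected s)
    (hd : Disjoint s (trace γ K)) {x y : Plane} (hx : x ∈ closure s) (hxK : x ∉ trace γ K)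
    (hy : y ∈ s) : wind γ K x = wind γ K y := by
  refine wind_eq_of_isPreconnected K (s := insert x s)
    (hs.subset_closure (Set.subset_insert _ _) (Set.insert_subset hx subset_closure)) ?_
    (Set.mem_insert _ _) (Set.mem_insert_of_mem _ hy)
  rw [Set.disjoint_left]
  rintro z (rfl | hz)
  · exact hxK
  · exact hd.notMem_of_mem_left hz

lemma not_isBounded_of_ray_subset {s : Set Plane} {x w : Plane} (hw : w ≠ 0)
    (h : ∀ t : ℝ, 0 ≤ t → x + t • w ∈ s) : ¬ Bornology.IsBounded s := by
  intro hb
  obtain ⟨R, hR⟩ := hb.exists_norm_le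
  have hw' := norm_pos_iff.2 hw
  have hR0 : 0 ≤ R := (norm_nonneg _).trans (hR _ (h 0 le_rfl))
  have h1 := hR _ (h ((R + ‖x‖ + 1) / ‖w‖) (by positivity))
  have h2 : ‖((R + ‖x‖ + 1) / ‖w‖) • w‖ = R + ‖x‖ + 1 := by
    rw [norm_smul, Real.norm_of_nonneg (by positivity)]
    field_simp
  have h3 := norm_sub_le (x + ((R + ‖x‖ + 1) / ‖w‖) • w) x
  rw [add_sub_cancel_left, h2] at h3
  linarith

/-- A half-plane that contains `x` and misses `s` is connected, unbounded and disjoint from the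
trace. -/
lemma wind_eq_zero_of_notMem_convex {v : V} (K : G.Walk v v) {s : Set Plane} (hs : Convex ℝ s)
    (hc : IsClosed s) (hne : s.Nonempty) (hK : trace γ K ⊆ s) {x : Plane} (hx : x ∉ s) :
    wind γ K x = 0 := by
  obtain ⟨f, u, hfu, hux⟩ := geometric_hahn_banach_closed_point hs hc hx
  obtain ⟨p, hp⟩ := hne
  refine wind_eq_zero_of_unbounded K (s := {y | u < f y}) ?_ ?_ ?_ hux
  · exact (convex_halfSpace_gt (f := f) f.isLinear u).isPreconnected
  · rw [Set.disjoint_left]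
    exact fun y hy hyK => (hfu y (hK hyK)).not_gt hy
  · have hw : 0 < f (x - p) := by
      rw [map_sub]
      linarith [hfu p hp]
    refine not_isBounded_of_ray_subset (x := x) (w := x - p) (fun e => ?_) fun t ht => ?_
    · rw [e, map_zero] at hw
      exact lt_irrefl _ hw
    · have : 0 ≤ t * f (x - p) := by positivity
      change u < f _
      rw [map_add f, map_smul f, smul_eq_mul]
      linarith

lemma IsPlanarDrawing.mem_support_of_mem_trace (hγ : IsPlanarDrawing G γ) {u v w : V}
    {q : G.Walk u v} (h : γ w ∈ trace γ q) : w ∈ q.support := by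
  obtain ⟨d, hd, hm⟩ := h
  rcases hγ.vertex_edge _ _ _ d.adj hm with rfl | rfl
  · exact q.dart_fst_mem_support_of_mem_darts hd
  · exact q.dart_snd_mem_support_of_mem_darts hd

lemma mem_trace_of_mem_support {u v w : V} {q : G.Walk u v} (hq : ¬ q.Nil) (h : w ∈ q.support) :
    γ w ∈ trace γ q := by
  induction q with
  | nil => simp at hq
  | @cons x y z hxy q ih =>
    rw [trace_cons]
    rw [SimpleGraph.Walk.support_cons, List.mem_cons] at h
    rcases h with rfl | h
    · exact Or.inl (left_mem_segment ℝ _ _)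
    · by_cases hn : q.Nil
      · cases hn
        simp only [SimpleGraph.Walk.support_nil, List.mem_singleton] at h
        subst h
        exact Or.inl (right_mem_segment ℝ _ _)
      · exact Or.inr (ih hn h)

lemma wind_vertex_eq_zero_of_isExternal (hγ : IsPlanarDrawing G γ) {v w : V} (K : G.Walk v v)
    (hw : w ∉ K.support) (he : IsExternal G γ w) : wind γ K (γ w) = 0 := by
  obtain ⟨F, hF, hwF⟩ := he
  obtain ⟨p, hp⟩ := hF.1.nonempty
  have hd := hF.1.disjoint_trace K
  rw [wind_eq_of_mem_closure K hF.1.isPreconnected hd (frontier_subset_closure hwF)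
    (fun h => hw (hγ.mem_support_of_mem_trace h)) hp]
  exact wind_eq_zero_of_unbounded K hF.1.isPreconnected hd hF.2 hp

lemma wind_eq_zero_of_not_isStrictlyInternalFace (hγ : IsPlanarDrawing G γ) {v : V}
    (K : G.Walk v v) (hK : ∀ w ∈ K.support, IsInternal G γ w) {F : Set Plane} (hF : IsFace G γ F)
    (hn : ¬ IsStrictlyInternalFace G γ F) {p : Plane} (hp : p ∈ F) : wind γ K p = 0 := by
  obtain ⟨w, hwF, hw⟩ : ∃ w, γ w ∈ frontier F ∧ IsExternal G γ w := by
    by_contra! h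
    exact hn ⟨hF, h⟩
  have hwK : w ∉ K.support := fun h => hK w h hw
  rw [← wind_eq_of_mem_closure K hF.isPreconnected (hF.disjoint_trace K)
    (frontier_subset_closure hwF) (fun h => hwK (hγ.mem_support_of_mem_trace h)) hp]
  exact wind_vertex_eq_zero_of_isExternal hγ K hwK hw

open scoped Classical in
lemma exists_count_ne {v : V} {C : G.Walk v v} (hC : C.IsCycle) :
    ∃ d : G.Dart, d ∈ C.darts ∧ C.darts.count d ≠ C.darts.count d.symm := by
  obtain ⟨d, hd⟩ : ∃ d, d ∈ C.darts := by
    cases C with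
    | nil => exact (hC.ne_nil rfl).elim
    | cons h q => exact ⟨⟨(_, _), h⟩, List.mem_cons_self⟩
  refine ⟨d, hd, ?_⟩
  have h1 : 0 < C.darts.count d := List.count_pos_iff.2 hd
  have h2 : d.symm ∉ C.darts := by
    intro h
    have hnd : (C.darts.map SimpleGraph.Dart.edge).Nodup := hC.isTrail.edges_nodup
    exact SimpleGraph.Dart.symm_ne d
      (List.inj_on_of_nodup_map hnd h hd (SimpleGraph.Dart.edge_symm d))
  rw [List.count_eq_zero.2 h2]
  exact h1.ne'

/-- A cycle does not run through an edge in both directions, so its winding number jumps across each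
of its edges and cannot vanish on both sides. -/
lemma exists_wind_leftPoint_ne_zero [Finite V] (hγ : IsPlanarDrawing G γ) {v : V} {C : G.Walk v v}
    (hC : C.IsCycle) : ∃ d : G.Dart, d ∈ C.darts ∧
      (wind γ C (leftPoint hγ d) ≠ 0 ∨ wind γ C (leftPoint hγ d.symm) ≠ 0) := by
  classical
  obtain ⟨d, hdC, hd⟩ := exists_count_ne hC
  refine ⟨d, hdC, ?_⟩
  by_contra! h
  have := wind_leftPoint_sub hγ d C
  rw [h.1, h.2, sub_zero, zero_eq_mul] at this
  rcases this with h0 | h0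
  · exact Real.two_pi_pos.ne' h0
  · rw [sub_eq_zero] at h0
    exact hd (by exact_mod_cast h0)

lemma IsFacialCycle.wind_eq_zero {F : Set Plane} {v : V} {C : G.Walk v v}
    (hC : IsFacialCycle γ F C) (hF : Convex ℝ F) {p : Plane} (hp : p ∉ drawing G γ) (hpF : p ∉ F) :
    wind γ C p = 0 := by
  refine wind_eq_zero_of_notMem_convex C hF.closure isClosed_closure hC.1.nonempty.closure ?_ ?_
  · rw [hC.2.2]
    exact frontier_subset_closure
  · rw [closure_eq_self_union_frontier, ← hC.2.2]
    rintro (h | h)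
    · exact hpF h
    · exact hp (trace_subset_drawing C h)

open scoped Classical in
/-- If an antisymmetric function sums to zero over the boundary cycle of a convex face, then it
sums to zero over all darts that have this face on their left. -/
lemma IsFacialCycle.sum_leftPoint_eq_zero [Finite V] [Fintype G.Dart] (hγ : IsPlanarDrawing G γ)
    {F : Set Plane} {v : V} {C : G.Walk v v} (hC : IsFacialCycle γ F C) (hF : Convex ℝ F)
    {σ : V → V → ℝ} (hσ : ∀ a b, σ b a = -σ a b)
    (h0 : (C.darts.map fun d => σ d.fst d.snd).sum = 0) :
    ∑ d : G.Dart with leftPoint hγ d ∈ F, σ d.fst d.snd = 0 := by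
  have key := two_pi_mul_sum_darts hγ C hσ
  obtain ⟨p, hp⟩ := hC.1.nonempty
  have hw : ∀ d : G.Dart, wind γ C (leftPoint hγ d)
      = if leftPoint hγ d ∈ F then wind γ C p else 0 := by
    intro d
    split_ifs with h
    · exact wind_eq_of_isPreconnected C hC.1.isPreconnected (hC.1.disjoint_trace C) h hp
    · exact hC.wind_eq_zero hF (leftPoint_notMem hγ d) h
  -- Only nonvanishing matters: the value on `F` is a common factor to cancel, so the orientation of
  -- `C` plays no role.
  have hne : wind γ C p ≠ 0 := by
    intro e
    simp only [e, ite_self] at hw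
    obtain ⟨d, -, h | h⟩ := exists_wind_leftPoint_ne_zero hγ hC.2.1
    · exact h (hw d)
    · exact h (hw d.symm)
  rw [h0, mul_zero] at key
  simp only [hw, ite_mul, zero_mul] at key
  rw [← Finset.sum_filter, ← Finset.mul_sum, zero_eq_mul] at key
  exact key.resolve_left hne

/-- An antisymmetric function that sums to zero over the boundary cycles of the strictly internal
faces sums to zero over every closed walk through internal vertices. -/
theorem sum_darts_eq_zero_of_faces [Finite V] (hγ : IsConvexDrawing G γ)
    {σ : V → V → ℝ} (hσ : ∀ a b, σ b a = -σ a b)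
    (h0 : ∀ F, IsStrictlyInternalFace G γ F → ∀ (v : V) (C : G.Walk v v), IsFacialCycle γ F C →
      (C.darts.map fun d => σ d.fst d.snd).sum = 0)
    {v : V} (K : G.Walk v v) (hK : ∀ w ∈ K.support, IsInternal G γ w) :
    (K.darts.map fun d => σ d.fst d.snd).sum = 0 := by
  classical
  have hfin : Finite G.Dart := Finite.of_injective SimpleGraph.Dart.toProd
    SimpleGraph.Dart.toProd_injective
  have := Fintype.ofFinite G.Dart
  have hp := hγ.toIsPlanarDrawing
  have key := two_pi_mul_sum_darts hp K hσ
  have hmem : ∀ d : G.Dart,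
      leftPoint hp d ∈ connectedComponentIn (drawing G γ)ᶜ (leftPoint hp d) := fun d =>
    mem_connectedComponentIn (leftPoint_notMem hp d)
  have hface : ∀ d : G.Dart,
      IsFace G γ (connectedComponentIn (drawing G γ)ᶜ (leftPoint hp d)) := fun d =>
    isFace_connectedComponentIn (leftPoint_notMem hp d)
  rw [← Finset.sum_fiberwise_of_maps_to (fun d hd => Finset.mem_image_of_mem
      (fun d : G.Dart => connectedComponentIn (drawing G γ)ᶜ (leftPoint hp d)) hd),
    Finset.sum_eq_zero] at key
  · exact (mul_eq_zero.1 key).resolve_left Real.two_pi_pos.ne'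
  intro F hF
  obtain ⟨d₀, -, rfl⟩ := Finset.mem_image.1 hF
  set F := connectedComponentIn (drawing G γ)ᶜ (leftPoint hp d₀) with hFdef
  have hfilter : ∀ d : G.Dart, connectedComponentIn (drawing G γ)ᶜ (leftPoint hp d) = F ↔
      leftPoint hp d ∈ F :=
    fun d => ⟨fun e => e ▸ hmem d, fun h => ((hface d₀).eq_connectedComponentIn h).symm⟩
  simp only [hfilter]
  by_cases hs : IsStrictlyInternalFace G γ F
  · obtain ⟨x, C, hC⟩ := hγ.exists_facialCycle F (hface d₀)
    -- Were `F` unbounded, the vertices of its own boundary cycle would be external.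
    have hb : Bornology.IsBounded F := by
      by_contra hb
      have hx : γ x ∈ frontier F := by
        rw [← hC.2.2]
        exact mem_trace_of_mem_support hC.2.1.not_nil C.start_mem_support
      exact hs.2 x hx ⟨F, ⟨hface d₀, hb⟩, hx⟩
    have hz := hC.sum_leftPoint_eq_zero hp (hγ.convex_of_bounded F (hface d₀) hb) hσ
      (h0 F hs x C hC)
    calc ∑ d : G.Dart with leftPoint hp d ∈ F, wind γ K (leftPoint hp d) * σ d.fst d.snd
        = ∑ d : G.Dart with leftPoint hp d ∈ F, wind γ K (leftPoint hp d₀) * σ d.fst d.snd := by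
          refine Finset.sum_congr rfl fun d hd => ?_
          rw [wind_eq_of_isPreconnected K (hface d₀).isPreconnected ((hface d₀).disjoint_trace K)
            (Finset.mem_filter.1 hd).2 (hmem d₀)]
      _ = 0 := by rw [← Finset.mul_sum, hz, mul_zero]
  · refine Finset.sum_eq_zero fun d hd => ?_
    rw [wind_eq_zero_of_not_isStrictlyInternalFace hp K hK (hface d₀) hs (Finset.mem_filter.1 hd).2,
      zero_mul]

/-! ### Triconnectivity and the outer face -/

/-- The working form of triconnectivity: a set closed under adjacency away from two vertices cannot
separate `a` from `b`. -/
lemma Triconnected.mem_of_adj_closed (hG : Triconnected G) {T S : Set V} (hT : T.Finite)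
    (hT2 : T.ncard ≤ 2) (hS : ∀ u ∈ S, ∀ w, G.Adj u w → w ∉ T → w ∈ S) {a b : V} (ha : a ∈ S)
    (haT : a ∉ T) (hbT : b ∉ T) : b ∈ S := by
  have h := (hG.2 T hT hT2).preconnected ⟨a, haT⟩ ⟨b, hbT⟩
  rw [SimpleGraph.reachable_iff_reflTransGen] at h
  suffices ∀ c : ↥Tᶜ, Relation.ReflTransGen (G.induce Tᶜ).Adj ⟨a, haT⟩ c → (c : V) ∈ S from
    this _ h
  intro c hc
  induction hc with
  | refl => exact ha
  | tail _ hadj ih => exact hS _ ih _ hadj (Subtype.property (p := (· ∈ Tᶜ)) _)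

lemma isBounded_drawing [Finite V] (G : SimpleGraph V) (γ : V → Plane) :
    Bornology.IsBounded (drawing G γ) := by
  refine (isBounded_convexHull (s := Set.range γ)).2 (Set.finite_range γ).isBounded |>.subset ?_
  rintro p (h | ⟨u, v, -, h⟩)
  · exact subset_convexHull ℝ _ h
  · exact (convex_convexHull ℝ _).segment_subset (subset_convexHull ℝ _ (Set.mem_range_self u))
      (subset_convexHull ℝ _ (Set.mem_range_self v)) h

lemma isPreconnected_norm_gt {R : ℝ} (hR : 0 ≤ R) : IsPreconnected {p : Plane | R < ‖p‖} := by
  have hrank : 1 < Module.rank ℝ Plane :=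
    Module.lt_rank_of_lt_finrank (by simp)
  have h := (isPreconnected_Ioi (a := R)).prod
    (isConnected_sphere hrank (0 : Plane) zero_le_one).isPreconnected
  have h2 := h.image (fun x : ℝ × Plane => x.1 • x.2) (by fun_prop)
  convert h2 using 1
  ext p
  constructor
  · intro hp
    have hp : R < ‖p‖ := hp
    have h0 : ‖p‖ ≠ 0 := by linarith
    refine ⟨(‖p‖, ‖p‖⁻¹ • p), ⟨hp, ?_⟩, ?_⟩
    · simp [norm_smul, h0]
    · simp [smul_smul, h0]
  · rintro ⟨⟨r, x⟩, ⟨hr, hx⟩, rfl⟩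
    have hr : R < r := hr
    have hx : ‖x‖ = 1 := by simpa using hx
    change R < ‖r • x‖
    rw [norm_smul, hx, mul_one, Real.norm_of_nonneg (by linarith)]
    exact hr

lemma exists_radius [Finite V] (G : SimpleGraph V) (γ : V → Plane) :
    ∃ R : ℝ, 0 ≤ R ∧ {p : Plane | R < ‖p‖} ⊆ (drawing G γ)ᶜ := by
  obtain ⟨R, hR, h⟩ := (isBounded_drawing G γ).exists_pos_norm_le
  exact ⟨R, hR.le, fun p hp hpd => (h p hpd).not_gt hp⟩

lemma exists_isOuterFace [Finite V] (G : SimpleGraph V) (γ : V → Plane) :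
    ∃ F, IsOuterFace G γ F := by
  obtain ⟨R, hR, h⟩ := exists_radius G γ
  obtain ⟨e, he⟩ := exists_norm_eq Plane zero_le_one
  have hn : ∀ t : ℝ, 0 ≤ t → (R + 1) • e + t • e ∈ {p : Plane | R < ‖p‖} := by
    intro t ht
    change R < ‖_‖
    rw [← add_smul, norm_smul, he, Real.norm_of_nonneg (by linarith)]
    linarith
  have h0 : (R + 1) • e ∈ {p : Plane | R < ‖p‖} := by simpa using hn 0 le_rfl
  refine ⟨_, isFace_connectedComponentIn (h h0), not_isBounded_of_ray_subset (x := (R + 1) • e)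
    (w := e) ?_ fun t ht => ?_⟩
  · rintro rfl
    simp at he
  · exact (isPreconnected_norm_gt hR).subset_connectedComponentIn h0 h (hn t ht)

lemma IsOuterFace.eq [Finite V] {F₁ F₂ : Set Plane} (h₁ : IsOuterFace G γ F₁)
    (h₂ : IsOuterFace G γ F₂) : F₁ = F₂ := by
  obtain ⟨R, hR, h⟩ := exists_radius G γ
  have hex : ∀ F, IsOuterFace G γ F → {p : Plane | R < ‖p‖} ⊆ F ∧ ∃ p ∈ F, R < ‖p‖ := by
    intro F hF
    obtain ⟨p, hp, hpR⟩ : ∃ p ∈ F, R < ‖p‖ := by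
      by_contra! hcon
      exact hF.2 (isBounded_iff_forall_norm_le.2 ⟨R, hcon⟩)
    refine ⟨?_, p, hp, hpR⟩
    rw [hF.1.eq_connectedComponentIn hp]
    exact (isPreconnected_norm_gt hR).subset_connectedComponentIn hpR h
  obtain ⟨p, hp, hpR⟩ := (hex F₁ h₁).2
  rw [h₁.1.eq_connectedComponentIn hp, h₂.1.eq_connectedComponentIn ((hex F₂ h₂).1 hpR)]

/-! ### The outer cycle and its arcs -/

/-- The closed walk `C` is a cycle through the external vertices that winds around everything
else in the drawing. -/
structure IsOuterCycle (γ : V → Plane) {v : V} (C : G.Walk v v) : Prop where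
  isCycle : C.IsCycle
  wind_ne_zero : ∀ p ∈ drawing G γ, p ∉ trace γ C → wind γ C p ≠ 0
  mem_support_iff : ∀ w, w ∈ C.support ↔ IsExternal G γ w

lemma IsConvexDrawing.exists_isOuterCycle [Finite V] (hγ : IsConvexDrawing G γ) :
    ∃ (v : V) (C : G.Walk v v), IsOuterCycle γ C := by
  have hp := hγ.toIsPlanarDrawing
  obtain ⟨O, hO⟩ := exists_isOuterFace G γ
  obtain ⟨v, C, hC⟩ := hγ.exists_facialCycle O hO.1
  refine ⟨v, C, hC.2.1, fun p hpd hpC => ?_, fun w => ?_⟩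
  · have hint : ∀ q, q ∉ O → q ∉ trace γ C → q ∈ interior Oᶜ := by
      intro q hq hqC
      rw [← self_sdiff_frontier, frontier_compl, ← hC.2.2]
      exact ⟨hq, hqC⟩
    have hD : Disjoint (interior Oᶜ) (trace γ C) := by
      rw [← self_sdiff_frontier, frontier_compl, ← hC.2.2]
      exact Set.disjoint_sdiff_left
    have hpre := (hγ.convex_compl_outer O hO).interior.isPreconnected
    have hpI := hint p (fun h => hO.1.disjoint_drawing.notMem_of_mem_left h hpd) hpC
    -- The interior of the convex complement of the outer face is connected and misses `C`, so one
    -- point with nonzero winding number suffices. A point beside a dart of `C` supplies it, since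
    -- the winding number is zero in the outer face.
    have hout : ∀ d, wind γ C (leftPoint hp d) ≠ 0 → wind γ C p ≠ 0 := by
      intro d hd
      have hdI := hint (leftPoint hp d)
        (fun h => hd (wind_eq_zero_of_unbounded C hO.1.isPreconnected (hO.1.disjoint_trace C)
          hO.2 h))
        (fun h => leftPoint_notMem hp d (trace_subset_drawing C h))
      rwa [wind_eq_of_isPreconnected C hpre hD hpI hdI]
    obtain ⟨d, -, h | h⟩ := exists_wind_leftPoint_ne_zero hp hC.2.1
    · exact hout _ h
    · exact hout _ h
  · constructor
    · exact fun h => ⟨O, hO, hC.2.2 ▸ mem_trace_of_mem_support hC.2.1.not_nil h⟩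
    · rintro ⟨F, hF, hw⟩
      rw [hF.eq hO, ← hC.2.2] at hw
      exact hp.mem_support_of_mem_trace hw

lemma IsOuterCycle.append_comm {x y : V} {q : G.Walk x y} {r : G.Walk y x}
    (h : IsOuterCycle γ (q.append r)) : IsOuterCycle γ (r.append q) := by
  have hd : (q.append r).darts.Perm (r.append q).darts := by
    simp only [SimpleGraph.Walk.darts_append]
    exact List.perm_append_comm
  refine ⟨?_, fun p hpd hp => ?_, fun w => ?_⟩
  · have hc := h.isCycle
    rw [SimpleGraph.Walk.isCycle_def] at hc ⊢
    obtain ⟨h1, h2, h3⟩ := hc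
    refine ⟨?_, ?_, ?_⟩
    · rw [SimpleGraph.Walk.isTrail_def, SimpleGraph.Walk.edges_append] at h1 ⊢
      exact List.nodup_append_comm.1 h1
    · intro e
      have := congrArg SimpleGraph.Walk.length e
      refine h2 (SimpleGraph.Walk.Nil.eq_nil (SimpleGraph.Walk.length_eq_zero_iff.1 ?_))
      rw [SimpleGraph.Walk.length_append, SimpleGraph.Walk.length_nil] at this
      rw [SimpleGraph.Walk.length_append]
      omega
    · rw [SimpleGraph.Walk.tail_support_append] at h3 ⊢
      exact List.nodup_append_comm.1 h3
  · rw [← trace_congr_perm hd] at hp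
    rw [← wind_congr_perm hd]
    exact h.wind_ne_zero p hpd hp
  · rw [← h.mem_support_iff, SimpleGraph.Walk.mem_support_append_iff,
      SimpleGraph.Walk.mem_support_append_iff, or_comm]

lemma IsOuterCycle.notMem_support_right {x y a : V} {q₁ : G.Walk x y} {q₂ : G.Walk y x}
    (h : IsOuterCycle γ (q₁.append q₂)) (ha : a ∈ q₁.support) (hx : a ≠ x) (hy : a ≠ y) :
    a ∉ q₂.support := by
  intro h2
  have hn := h.isCycle.support_nodup
  rw [SimpleGraph.Walk.tail_support_append, List.nodup_append'] at hn
  rw [SimpleGraph.Walk.mem_support_iff] at ha h2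
  exact hn.2.2 (ha.resolve_left hx) (h2.resolve_left hy)

/-- Only the half of the edge next to `a` is used because `b` may lie on `K`. Planarity leaves `b`
as the only possible common point, and it is not on that half. -/
lemma disjoint_half_segment_trace (hγ : IsPlanarDrawing G γ) {a b u v : V} (hab : G.Adj a b)
    {K : G.Walk u v} (ha : a ∉ K.support) :
    Disjoint (segment ℝ (midpoint ℝ (γ a) (γ b)) (γ a)) (trace γ K) := by
  rw [Set.disjoint_left]
  rintro p hp ⟨d, hd, hpd⟩
  have h1 := K.dart_fst_mem_support_of_mem_darts hd
  have h2 := K.dart_snd_mem_support_of_mem_darts hd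
  have hne : s(a, b) ≠ s(d.fst, d.snd) := by
    intro e
    rcases Sym2.eq_iff.1 e with ⟨e, -⟩ | ⟨e, -⟩
    · exact ha (e ▸ h1)
    · exact ha (e ▸ h2)
  have hp' : p ∈ segment ℝ (γ a) (γ b) :=
    (convex_segment _ _).segment_subset (midpoint_mem_segment _ _) (left_mem_segment ℝ _ _) hp
  obtain ⟨w, rfl, hw, hw'⟩ := hγ.exists_common_endpoint hab d.adj hne hp' hpd
  have hwa : w ≠ a := by
    rintro rfl
    rcases hw' with rfl | rfl
    · exact ha h1
    · exact ha h2
  obtain rfl := hw.resolve_left hwa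
  obtain ⟨s, t, hs, ht, hst, e⟩ := hp
  have e' : (s / 2 + t) • (γ a - γ w) = 0 := by
    have hs' : s = 1 - t := by linarith
    rw [midpoint_eq_smul_add, invOf_eq_inv, ← sub_eq_zero] at e
    subst hs'
    rw [← e]
    module
  rcases smul_eq_zero.1 e' with h0 | h0
  · linarith
  · exact hwa (hγ.injective (sub_eq_zero.1 h0)).symm

lemma wind_midpoint_eq (hγ : IsPlanarDrawing G γ) {a b v : V} (hab : G.Adj a b)
    {K : G.Walk v v} (ha : a ∉ K.support) :
    wind γ K (midpoint ℝ (γ a) (γ b)) = wind γ K (γ a) :=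
  wind_eq_of_isPreconnected K (convex_segment _ _).isPreconnected
    (disjoint_half_segment_trace hγ hab ha) (left_mem_segment ℝ _ _) (right_mem_segment ℝ _ _)

lemma wind_eq_of_adj (hγ : IsPlanarDrawing G γ) {a b v : V} (hab : G.Adj a b)
    {K : G.Walk v v} (ha : a ∉ K.support) (hb : b ∉ K.support) :
    wind γ K (γ a) = wind γ K (γ b) := by
  rw [← wind_midpoint_eq hγ hab ha, ← wind_midpoint_eq hγ hab.symm hb, midpoint_comm]

/-- The path `P` cuts the cycle into two loops and is traversed once each way, so its angles cancel.
-/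
lemma wind_add_wind_eq {x y : V} (q₁ : G.Walk x y) (q₂ : G.Walk y x) (P : G.Walk y x) {p : Plane}
    (hp : p ∉ trace γ P) :
    wind γ (q₁.append P) p + wind γ (P.reverse.append q₂) p = wind γ (q₁.append q₂) p := by
  simp only [wind_append, wind_reverse P hp]
  ring

section Arcs

variable {x y : V} {q₁ : G.Walk x y} {q₂ P : G.Walk y x}

lemma IsOuterCycle.notMem_support_arc (hC : IsOuterCycle γ (q₁.append q₂))
    (hP : ∀ w ∈ P.support, w = x ∨ w = y ∨ IsInternal G γ w)
    {a : V} (ha : a ∈ q₁.support) (hax : a ≠ x) (hay : a ≠ y) :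
    a ∉ (P.reverse.append q₂).support := by
  rw [SimpleGraph.Walk.mem_support_append_iff, SimpleGraph.Walk.support_reverse, List.mem_reverse]
  rintro (h | h)
  · rcases hP a h with h | h | h
    · exact hax h
    · exact hay h
    · exact h ((hC.mem_support_iff a).1 (SimpleGraph.Walk.mem_support_append_iff _ _ |>.2 (Or.inl ha)))
  · exact hC.notMem_support_right ha hax hay h

/-- The two open arcs of the outer cycle between the ends of a path through the interior are
not joined by an edge. -/
lemma IsOuterCycle.not_adj_of_arcs (hγ : IsPlanarDrawing G γ)
    (hC : IsOuterCycle γ (q₁.append q₂)) (hP : ∀ w ∈ P.support, w = x ∨ w = y ∨ IsInternal G γ w)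
    {a b : V} (ha : a ∈ q₁.support) (hax : a ≠ x) (hay : a ≠ y) (hb : b ∈ q₂.support)
    (hb₁ : b ∉ q₁.support) : ¬ G.Adj a b := by
  intro hab
  have ha2 := hC.notMem_support_right ha hax hay
  have haE : IsExternal G γ a :=
    (hC.mem_support_iff a).1 (SimpleGraph.Walk.mem_support_append_iff _ _ |>.2 (Or.inl ha))
  have hbE : IsExternal G γ b :=
    (hC.mem_support_iff b).1 (SimpleGraph.Walk.mem_support_append_iff _ _ |>.2 (Or.inr hb))
  have haK := hC.notMem_support_arc hP ha hax hay
  have hbP : b ∉ P.support := by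
    intro h
    rcases hP b h with rfl | rfl | h
    · exact hb₁ q₁.start_mem_support
    · exact hb₁ q₁.end_mem_support
    · exact h hbE
  have hbK : b ∉ (q₁.append P).support := by
    rw [SimpleGraph.Walk.mem_support_append_iff, not_or]
    exact ⟨hb₁, hbP⟩
  have hmP : midpoint ℝ (γ a) (γ b) ∉ trace γ P := by
    have := disjoint_half_segment_trace hγ hab.symm hbP
    rw [midpoint_comm] at this
    exact this.notMem_of_mem_left (left_mem_segment ℝ _ _)
  -- Each of the two loops misses one end of `ab`, an external vertex, so neither winds around the
  -- midpoint. Their sum, the outer cycle, does.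
  have h1 : wind γ (q₁.append P) (midpoint ℝ (γ a) (γ b)) = 0 := by
    rw [midpoint_comm, wind_midpoint_eq hγ hab.symm hbK]
    exact wind_vertex_eq_zero_of_isExternal hγ _ hbK hbE
  have h2 : wind γ (P.reverse.append q₂) (midpoint ℝ (γ a) (γ b)) = 0 := by
    rw [wind_midpoint_eq hγ hab haK]
    exact wind_vertex_eq_zero_of_isExternal hγ _ haK haE
  have h3 := wind_add_wind_eq q₁ q₂ P hmP
  rw [h1, h2, add_zero] at h3
  refine hC.wind_ne_zero _ (Or.inr ⟨a, b, hab, midpoint_mem_segment _ _⟩) ?_ h3.symm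
  rw [trace_append, Set.mem_union, not_or]
  constructor
  · have := disjoint_half_segment_trace hγ hab.symm hb₁
    rw [midpoint_comm] at this
    exact this.notMem_of_mem_left (left_mem_segment ℝ _ _)
  · exact (disjoint_half_segment_trace hγ hab ha2).notMem_of_mem_left (left_mem_segment ℝ _ _)

lemma IsOuterCycle.wind_ne_zero_of_isInternal (hγ : IsPlanarDrawing G γ) {v : V} {C : G.Walk v v}
    (hC : IsOuterCycle γ C) {b : V} (hb : IsInternal G γ b) : wind γ C (γ b) ≠ 0 :=
  hC.wind_ne_zero _ (Or.inl ⟨b, rfl⟩) fun h =>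
    hb ((hC.mem_support_iff b).1 (hγ.mem_support_of_mem_trace h))

/-- The loop through the other arc does not wind around the external vertex `a`, hence not around
its neighbour `b`. The whole winding number of the outer cycle around `b` therefore falls to the
loop through `q₁`. -/
lemma IsOuterCycle.wind_ne_zero_of_adj_arc (hγ : IsPlanarDrawing G γ)
    (hC : IsOuterCycle γ (q₁.append q₂)) (hP : ∀ w ∈ P.support, w = x ∨ w = y ∨ IsInternal G γ w)
    {a b : V} (ha : a ∈ q₁.support) (hax : a ≠ x) (hay : a ≠ y) (hb : IsInternal G γ b)
    (hbP : b ∉ P.support) (hab : G.Adj a b) : wind γ (q₁.append P) (γ b) ≠ 0 := by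
  have haE : IsExternal G γ a :=
    (hC.mem_support_iff a).1 (SimpleGraph.Walk.mem_support_append_iff _ _ |>.2 (Or.inl ha))
  have haK := hC.notMem_support_arc hP ha hax hay
  have hbK : b ∉ (P.reverse.append q₂).support := by
    rw [SimpleGraph.Walk.mem_support_append_iff, SimpleGraph.Walk.support_reverse,
      List.mem_reverse, not_or]
    exact ⟨hbP, fun h => hb ((hC.mem_support_iff b).1
      (SimpleGraph.Walk.mem_support_append_iff _ _ |>.2 (Or.inr h)))⟩
  have h3 := wind_add_wind_eq (γ := γ) q₁ q₂ P
    (fun h => hbP (hγ.mem_support_of_mem_trace h) : γ b ∉ trace γ P)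
  rw [← wind_eq_of_adj hγ hab haK hbK, wind_vertex_eq_zero_of_isExternal hγ _ haK haE,
    add_zero] at h3
  rw [h3]
  exact hC.wind_ne_zero_of_isInternal hγ hb

end Arcs

lemma ncard_pair_le_two (x y : V) : ({x, y} : Set V).ncard ≤ 2 :=
  (Set.ncard_insert_le x {y}).trans (by rw [Set.ncard_singleton])

lemma exists_isInternal [Finite V] (hG : Triconnected G) (hγ : IsConvexDrawing G γ) :
    ∃ v, IsInternal G γ v := by
  by_contra! hall
  have hext : ∀ w, IsExternal G γ w := fun w => not_not.1 (hall w)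
  have hp := hγ.toIsPlanarDrawing
  obtain ⟨v, C, hC⟩ := hγ.exists_isOuterCycle
  -- Without internal vertices the outer cycle is Hamiltonian. It has a chord at `v`, since
  -- otherwise the two cycle neighbours of `v` would separate it from a fourth vertex.
  obtain ⟨w, hvw, hw⟩ : ∃ w, G.Adj v w ∧ s(v, w) ∉ C.edges := by
    by_contra! hcon
    have hT := hC.isCycle.ncard_neighborSet_toSubgraph_eq_two C.start_mem_support
    set T := C.toSubgraph.neighborSet v with hTdef
    have hvT : v ∉ T := fun h => (C.toSubgraph.adj_sub h).ne rfl
    have huniv : (Set.univ : Set V) ⊆ insert v T := by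
      intro b _
      by_contra hb
      rw [Set.mem_insert_iff, not_or] at hb
      refine hb.1 (hG.mem_of_adj_closed (T := T) (S := {v}) (Set.toFinite T) hT.le ?_ rfl hvT hb.2)
      rintro u rfl w huw hwT
      exact (hwT (SimpleGraph.Walk.adj_toSubgraph_iff_mem_edges.2 (hcon w huw))).elim
    have h1 := Set.ncard_le_ncard huniv (Set.toFinite _)
    have h2 := Set.ncard_insert_le v T
    rw [Set.ncard_univ] at h1
    have := hG.1
    omega
  obtain ⟨q₁, q₂, rfl⟩ :=
    SimpleGraph.Walk.mem_support_iff_exists_append.1 ((hC.mem_support_iff w).2 (hext w))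
  rw [SimpleGraph.Walk.edges_append, List.mem_append, not_or] at hw
  let P : G.Walk w v := .cons hvw.symm .nil
  have hP : ∀ a ∈ P.support, a = v ∨ a = w ∨ IsInternal G γ a := by
    intro a ha
    have : a = w ∨ a = v := by simpa [P] using ha
    tauto
  obtain ⟨a, ha, hav, haw⟩ : ∃ a ∈ q₁.support, a ≠ v ∧ a ≠ w := by
    cases q₁ with
    | nil => exact (hvw.ne rfl).elim
    | @cons _ a _ h q =>
      refine ⟨a, by simp, h.ne', ?_⟩
      rintro rfl
      exact hw.1 (by simp)
  obtain ⟨b, hb, hbv, hbw⟩ : ∃ b ∈ q₂.support, b ≠ v ∧ b ≠ w := by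
    cases q₂ with
    | nil => exact (hvw.ne rfl).elim
    | @cons _ b _ h q =>
      refine ⟨b, by simp, ?_, h.ne'⟩
      rintro rfl
      exact hw.2 (by simp [Sym2.eq_swap])
  -- The ends of the chord separate the two open arcs.
  have hbS := hG.mem_of_adj_closed (T := {v, w})
    (S := {a | a ∈ q₁.support ∧ a ≠ v ∧ a ≠ w}) (Set.toFinite _) (ncard_pair_le_two v w) ?_
    (a := a) (b := b) ⟨ha, hav, haw⟩ (by simp [hav, haw]) (by simp [hbv, hbw])
  · exact hC.notMem_support_right hbS.1 hbS.2.1 hbS.2.2 hb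
  · rintro u ⟨hu, huv, huw⟩ z huz hz
    rw [Set.mem_insert_iff, Set.mem_singleton_iff, not_or] at hz
    refine ⟨?_, hz⟩
    by_contra hz1
    have hzC := (hC.mem_support_iff z).2 (hext z)
    rw [SimpleGraph.Walk.mem_support_append_iff] at hzC
    exact hC.not_adj_of_arcs hp hP hu huv huw (hzC.resolve_left hz1) hz1 huz

/-! ### Connectedness of the internal vertices -/

/-- The vertices that are joined to `r` by a walk through internal vertices. -/
def internalComponent (G : SimpleGraph V) (γ : V → Plane) (r : V) : Set V :=
  {v | ∃ q : G.Walk r v, ∀ w ∈ q.support, IsInternal G γ w}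

lemma mem_internalComponent_of_adj {r u w : V} (hu : u ∈ internalComponent G γ r)
    (huw : G.Adj u w) (hw : IsInternal G γ w) : w ∈ internalComponent G γ r := by
  obtain ⟨q, hq⟩ := hu
  refine ⟨q.concat huw, fun z hz => ?_⟩
  rw [SimpleGraph.Walk.support_concat, List.mem_append,
    List.mem_singleton] at hz
  rcases hz with hz | rfl
  · exact hq z hz
  · exact hw

lemma isInternal_of_mem_internalComponent {r u : V} (hu : u ∈ internalComponent G γ r) :
    IsInternal G γ u := by
  obtain ⟨q, hq⟩ := hu
  exact hq u q.end_mem_support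

lemma support_subset_internalComponent {r u : V} (q : G.Walk r u)
    (hq : ∀ w ∈ q.support, IsInternal G γ w) : ∀ w ∈ q.support, w ∈ internalComponent G γ r := by
  intro w hw
  obtain ⟨q₁, q₂, rfl⟩ := SimpleGraph.Walk.mem_support_iff_exists_append.1 hw
  exact ⟨q₁, fun z hz => hq z (SimpleGraph.Walk.mem_support_append_iff _ _ |>.2 (Or.inl hz))⟩

/-- The external vertices with a neighbour in the component of `r`. -/
def attachments (G : SimpleGraph V) (γ : V → Plane) (r : V) : Set V :=
  {x | IsExternal G γ x ∧ ∃ a ∈ internalComponent G γ r, G.Adj a x}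

lemma exists_walk_of_mem_attachments {r x : V} (hx : x ∈ attachments G γ r) :
    ∃ P : G.Walk r x, ∀ w ∈ P.support, w = x ∨ w ∈ internalComponent G γ r := by
  obtain ⟨-, a, ⟨q, hq⟩, hax⟩ := hx
  refine ⟨q.concat hax, fun z hz => ?_⟩
  rw [SimpleGraph.Walk.support_concat, List.mem_append,
    List.mem_singleton] at hz
  exact hz.symm.imp_right (support_subset_internalComponent q hq z)

/-- If the ends of an arc of the outer cycle are its only attachments of the component of `r`,
then the arc, closed through that component, does not wind around another internal vertex. -/
lemma wind_arc_eq_zero [Finite V] (hG : Triconnected G) (hγ : IsPlanarDrawing G γ)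
    {r b x y : V} (hr : IsInternal G γ r) (hb : IsInternal G γ b)
    (hbA : b ∉ internalComponent G γ r) {q₁ : G.Walk x y} {q₂ P : G.Walk y x}
    (hC : IsOuterCycle γ (q₁.append q₂))
    (hP : ∀ w ∈ P.support, w = x ∨ w = y ∨ w ∈ internalComponent G γ r)
    (hq : ∀ z ∈ q₁.support, z ∈ attachments G γ r → z = x ∨ z = y) :
    wind γ (q₁.append P) (γ b) = 0 := by
  by_contra hne
  have hP' : ∀ w ∈ P.support, w = x ∨ w = y ∨ IsInternal G γ w := fun w hw =>
    (hP w hw).imp_right (Or.imp_right isInternal_of_mem_internalComponent)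
  have hE₁ : ∀ w ∈ q₁.support, IsExternal G γ w := fun w hw =>
    (hC.mem_support_iff w).1 (SimpleGraph.Walk.mem_support_append_iff _ _ |>.2 (Or.inl hw))
  have hxE := hE₁ x q₁.start_mem_support
  have hyE := hE₁ y q₁.end_mem_support
  have hIP : ∀ w, IsInternal G γ w → w ∉ internalComponent G γ r → w ∉ P.support := by
    intro w hw hwA h
    rcases hP w h with rfl | rfl | h
    · exact hw hxE
    · exact hw hyE
    · exact hwA h
  have hIK : ∀ w, IsInternal G γ w → w ∉ internalComponent G γ r →
      w ∉ (q₁.append P).support := by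
    intro w hw hwA h
    rw [SimpleGraph.Walk.mem_support_append_iff] at h
    exact h.elim (fun h => hw (hE₁ w h)) (hIP w hw hwA)
  have hEP : ∀ w, IsExternal G γ w → w ≠ x → w ≠ y → w ∉ P.support := by
    intro w hw hwx hwy h
    rcases hP' w h with h | h | h
    · exact hwx h
    · exact hwy h
    · exact h hw
  -- The separated side consists of the open arc and of the internal vertices outside the component
  -- of `r` that the loop winds around. Only `x` and `y` lead out of it; it contains `b` but not
  -- `r`.
  have hrS := hG.mem_of_adj_closed (T := {x, y})
    (S := {a | (a ∈ q₁.support ∧ a ≠ x ∧ a ≠ y) ∨ (IsInternal G γ a ∧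
      a ∉ internalComponent G γ r ∧ wind γ (q₁.append P) (γ a) ≠ 0)})
    (Set.toFinite _) (ncard_pair_le_two x y) ?_ (a := b) (b := r) (Or.inr ⟨hb, hbA, hne⟩)
    (by rintro (rfl | rfl) <;> contradiction) (by rintro (rfl | rfl) <;> contradiction)
  · rcases hrS with h | h
    · exact hr (hE₁ r h.1)
    · refine h.2.1 ⟨.nil, fun w hw => ?_⟩
      rw [SimpleGraph.Walk.support_nil, List.mem_singleton] at hw
      rwa [hw]
  rintro u hu w huw hw
  rw [Set.mem_insert_iff, Set.mem_singleton_iff, not_or] at hw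
  by_cases hwq : w ∈ q₁.support
  · exact Or.inl ⟨hwq, hw⟩
  by_cases hwE : IsExternal G γ w
  · exfalso
    rcases hu with ⟨hu, hux, huy⟩ | ⟨huI, huA, huw0⟩
    · have hwC := (hC.mem_support_iff w).2 hwE
      rw [SimpleGraph.Walk.mem_support_append_iff] at hwC
      exact hC.not_adj_of_arcs hγ hP' hu hux huy (hwC.resolve_left hwq) hwq huw
    · have hwK : w ∉ (q₁.append P).support := by
        rw [SimpleGraph.Walk.mem_support_append_iff, not_or]
        exact ⟨hwq, hEP w hwE hw.1 hw.2⟩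
      apply huw0
      rw [wind_eq_of_adj hγ huw (hIK u huI huA) hwK]
      exact wind_vertex_eq_zero_of_isExternal hγ _ hwK hwE
  · by_cases hwA : w ∈ internalComponent G γ r
    · exfalso
      rcases hu with ⟨hu, hux, huy⟩ | ⟨huI, huA, -⟩
      · exact (hq u hu ⟨hE₁ u hu, w, hwA, huw.symm⟩).elim hux huy
      · exact huA (mem_internalComponent_of_adj hwA huw.symm huI)
    · refine Or.inr ⟨hwE, hwA, ?_⟩
      rcases hu with ⟨hu, hux, huy⟩ | ⟨huI, huA, huw0⟩
      · exact hC.wind_ne_zero_of_adj_arc hγ hP' hu hux huy hwE (hIP w hwE hwA) huw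
      · rwa [← wind_eq_of_adj hγ huw (hIK u huI huA) (hIK w hwE hwA)]

/-- The internal vertices induce a connected subgraph. -/
theorem exists_internal_walk [Finite V] (hG : Triconnected G) (hγ : IsConvexDrawing G γ) {r b : V}
    (hr : IsInternal G γ r) (hb : IsInternal G γ b) :
    ∃ q : G.Walk r b, ∀ w ∈ q.support, IsInternal G γ w := by
  change b ∈ internalComponent G γ r
  by_contra hbA
  have hp := hγ.toIsPlanarDrawing
  have hrA : r ∈ internalComponent G γ r := by
    refine ⟨.nil, fun w hw => ?_⟩
    rw [SimpleGraph.Walk.support_nil, List.mem_singleton] at hw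
    rwa [hw]
  choose P hP using fun x (hx : x ∈ attachments G γ r) => exists_walk_of_mem_attachments hx
  have hbP : ∀ x (hx : x ∈ attachments G γ r), γ b ∉ trace γ (P x hx) := by
    intro x hx h
    rcases hP x hx b (hp.mem_support_of_mem_trace h) with rfl | h
    · exact hb hx.1
    · exact hbA h
  -- Each attachment `x` has a path `P x` from `r`. The loop along `q₁` and back through `r` does
  -- not wind around `b`: cut at an inner attachment, it becomes a sum of two loops over shorter
  -- arcs, and without one `wind_arc_eq_zero` applies.
  have main : ∀ n : ℕ, ∀ x y (q₁ : G.Walk x y) (q₂ : G.Walk y x), q₁.length = n →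
      ∀ (hx : x ∈ attachments G γ r) (hy : y ∈ attachments G γ r),
      IsOuterCycle γ (q₁.append q₂) →
      wind γ q₁ (γ b) - wind γ (P y hy) (γ b) + wind γ (P x hx) (γ b) = 0 := by
    intro n
    induction n using Nat.strong_induction_on with
    | _ n ih =>
      intro x y q₁ q₂ hn hx hy hC
      by_cases hz : ∃ z ∈ q₁.support, z ∈ attachments G γ r ∧ z ≠ x ∧ z ≠ y
      · obtain ⟨z, hz, hzN, hzx, hzy⟩ := hz
        obtain ⟨t, d, rfl⟩ := SimpleGraph.Walk.mem_support_iff_exists_append.1 hz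
        have ht : t.length ≠ 0 := fun h => hzx (SimpleGraph.Walk.eq_of_length_eq_zero h).symm
        have hd : d.length ≠ 0 := fun h => hzy (SimpleGraph.Walk.eq_of_length_eq_zero h)
        rw [SimpleGraph.Walk.length_append] at hn
        rw [← SimpleGraph.Walk.append_assoc] at hC
        have hC' := hC.append_comm
        rw [← SimpleGraph.Walk.append_assoc] at hC'
        have h1 := ih t.length (by omega) x z t _ rfl hx hzN hC
        have h2 := ih d.length (by omega) z y d _ rfl hzN hy hC'
        rw [wind_append]
        linarith
      · push Not at hz
        have := wind_arc_eq_zero hG hp hr hb hbA (P := (P y hy).reverse.append (P x hx)) hC ?_ ?_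
        · rw [wind_append, wind_append, wind_reverse _ (hbP y hy)] at this
          linarith
        · intro w hw
          rw [SimpleGraph.Walk.mem_support_append_iff, SimpleGraph.Walk.support_reverse,
            List.mem_reverse] at hw
          rcases hw with hw | hw
          · exact Or.inr (hP y hy w hw)
          · exact (hP x hx w hw).imp_right Or.inr
        · intro z hzq hzN
          by_cases h : z = x
          · exact Or.inl h
          · exact Or.inr (hz z hzq hzN h)
  obtain ⟨x, hx⟩ : ∃ x, x ∈ attachments G γ r := by
    by_contra! hno
    refine hbA (hG.mem_of_adj_closed (T := ∅) (Set.toFinite _) (by simp) ?_ hrA (by simp) (by simp))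
    intro u hu w huw _
    refine mem_internalComponent_of_adj hu huw fun hw => hno w ⟨hw, u, hu, huw⟩
  obtain ⟨v, C, hC⟩ := hγ.exists_isOuterCycle
  obtain ⟨t, d, rfl⟩ := SimpleGraph.Walk.mem_support_iff_exists_append.1 ((hC.mem_support_iff x).2 hx.1)
  have hC' := hC.append_comm
  -- The arc is now the full turn from `x` to `x`, with the trivial walk as its complement. The two
  -- path terms cancel, so the outer cycle would not wind around `b`.
  have h0 := main _ x x (d.append t) .nil rfl hx hx (by rwa [SimpleGraph.Walk.append_nil])
  rw [sub_add_cancel] at h0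
  exact hC'.wind_ne_zero_of_isInternal hp hb h0

/-! ### Scale factors along walks -/

/-- The edge equations telescope. On a closed walk both ends carry the same factor `s u`, which
cancels when it is nonzero. -/
lemma mul_prod_darts_eq {z : V → V → ℝ} {s : V → ℝ}
    (hs : ∀ i j, IsStrictlyInternalEdge G γ i j → s i * z i j = s j * z j i) {u v : V}
    (q : G.Walk u v) (hq : ∀ w ∈ q.support, IsInternal G γ w) :
    s u * (q.darts.map fun d => z d.fst d.snd).prod
      = s v * (q.darts.map fun d => z d.snd d.fst).prod := by
  induction q with
  | nil => rfl
  | @cons u v w h q ih =>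
    simp only [SimpleGraph.Walk.support_cons, List.mem_cons, forall_eq_or_imp] at hq
    simp only [SimpleGraph.Walk.darts_cons, List.map_cons, List.prod_cons]
    have h1 := hs u v ⟨h, hq.1, hq.2 v q.start_mem_support⟩
    have h2 := ih hq.2
    linear_combination (q.darts.map fun d => z d.fst d.snd).prod * h1 + z v u * h2

lemma ne_zero_of_internal_walk {z : V → V → ℝ} {s : V → ℝ}
    (hz : ∀ i j, IsStrictlyInternalEdge G γ i j → 0 < z i j)
    (hs : ∀ i j, IsStrictlyInternalEdge G γ i j → s i * z i j = s j * z j i) {u v : V}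
    (q : G.Walk u v) (hq : ∀ w ∈ q.support, IsInternal G γ w) (hu : s u ≠ 0) : s v ≠ 0 := by
  induction q with
  | nil => exact hu
  | @cons u v w h q ih =>
    simp only [SimpleGraph.Walk.support_cons, List.mem_cons, forall_eq_or_imp] at hq
    have he : IsStrictlyInternalEdge G γ u v := ⟨h, hq.1, hq.2 v q.start_mem_support⟩
    refine ih hq.2 fun hv => ?_
    have h1 := hs u v he
    rw [hv, zero_mul] at h1
    exact mul_ne_zero hu (hz u v he).ne' h1

lemma sum_darts_reverse {σ : V → V → ℝ} (hσ : ∀ a b, σ b a = -σ a b) {u v : V} (q : G.Walk u v) :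
    (q.reverse.darts.map fun d => σ d.fst d.snd).sum
      = -(q.darts.map fun d => σ d.fst d.snd).sum := by
  induction q with
  | nil => simp
  | @cons u v w h q ih =>
    simp only [SimpleGraph.Walk.reverse_cons, SimpleGraph.Walk.darts_append, List.map_append,
      List.sum_append, ih, SimpleGraph.Walk.darts_cons, SimpleGraph.Walk.darts_nil, List.map_cons,
      List.map_nil, List.sum_cons, List.sum_nil, hσ u v]
    ring

lemma CycleProductEq.sum_log_eq_zero {z : V → V → ℝ} {u v : V} {q : G.Walk u v}
    (h : CycleProductEq z q) (hz : ∀ d ∈ q.darts, 0 < z d.fst d.snd ∧ 0 < z d.snd d.fst) :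
    (q.darts.map fun d => Real.log (z d.fst d.snd) - Real.log (z d.snd d.fst)).sum = 0 := by
  have h1 := congrArg Real.log h
  rw [Real.log_list_prod, Real.log_list_prod, List.map_map, List.map_map] at h1
  · rw [← Multiset.sum_coe, ← Multiset.map_coe, Multiset.sum_map_sub, sub_eq_zero]
    exact h1
  · intro x hx
    obtain ⟨d, hd, rfl⟩ := List.mem_map.1 hx
    exact (hz d hd).2.ne'
  · intro x hx
    obtain ⟨d, hd, rfl⟩ := List.mem_map.1 hx
    exact (hz d hd).1.ne'

lemma IsFacialCycle.isInternal_of_mem_support {F : Set Plane} (hF : IsStrictlyInternalFace G γ F)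
    {v : V} {C : G.Walk v v} (hC : IsFacialCycle γ F C) :
    ∀ w ∈ C.support, IsInternal G γ w := fun w hw =>
  hF.2 w (hC.2.2 ▸ mem_trace_of_mem_support hC.2.1.not_nil hw)

end BaryDrawing

theorem theorem2 {V : Type*} [Fintype V] (G : SimpleGraph V) [DecidableRel G.Adj]
    (γ : V → Plane) (z : V → V → ℝ)
    (hG : BaryDrawing.Triconnected G)
    (hγ : BaryDrawing.IsConvexDrawing G γ)
    (hz : BaryDrawing.IsBarycentricWeights G γ z) :
    (∃ s : {v : V // BaryDrawing.IsInternal G γ v} → ℝ,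
        s ≠ 0 ∧ BaryDrawing.IsScaleSolution G γ z s) ↔
      ∀ F : Set Plane, BaryDrawing.IsStrictlyInternalFace G γ F →
        ∀ (v : V) (C : G.Walk v v), BaryDrawing.IsFacialCycle γ F C →
          BaryDrawing.CycleProductEq z C := by
  classical
  constructor
  · rintro ⟨s, hs0, hs⟩ F hF v C hC
    obtain ⟨i, hi⟩ := Function.ne_iff.1 hs0
    -- The value 0 at external vertices is never used: only strictly internal edges occur.
    let s' : V → ℝ := fun v => if h : BaryDrawing.IsInternal G γ v then s ⟨v, h⟩ else 0
    have hs' : ∀ i j, BaryDrawing.IsStrictlyInternalEdge G γ i j →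
        s' i * z i j = s' j * z j i := by
      rintro i j ⟨hij, hi, hj⟩
      simp only [s', dif_pos hi, dif_pos hj]
      exact sub_eq_zero.1 (hs ⟨i, hi⟩ ⟨j, hj⟩ hij)
    have hI := hC.isInternal_of_mem_support hF
    obtain ⟨q, hq⟩ := BaryDrawing.exists_internal_walk hG hγ i.2 (hI v C.start_mem_support)
    have hv : s' v ≠ 0 := by
      refine BaryDrawing.ne_zero_of_internal_walk hz.pos hs' q hq ?_
      simp only [s', dif_pos i.2]
      exact hi
    exact mul_left_cancel₀ hv (BaryDrawing.mul_prod_darts_eq hs' C hI)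
  · intro h
    obtain ⟨r, hr⟩ := BaryDrawing.exists_isInternal hG hγ
    choose Q hQ using fun i : {v : V // BaryDrawing.IsInternal G γ v} =>
      BaryDrawing.exists_internal_walk hG hγ hr i.2
    let σ : V → V → ℝ := fun a b => Real.log (z a b) - Real.log (z b a)
    have hσ : ∀ a b, σ b a = -σ a b := fun a b => (neg_sub _ _).symm
    have hface : ∀ F, BaryDrawing.IsStrictlyInternalFace G γ F → ∀ (v : V) (C : G.Walk v v),
        BaryDrawing.IsFacialCycle γ F C → (C.darts.map fun d => σ d.fst d.snd).sum = 0 := by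
      intro F hF v C hC
      have hI := hC.isInternal_of_mem_support hF
      refine (h F hF v C hC).sum_log_eq_zero fun d hd => ?_
      have h1 := hI _ (C.dart_fst_mem_support_of_mem_darts hd)
      have h2 := hI _ (C.dart_snd_mem_support_of_mem_darts hd)
      exact ⟨hz.pos _ _ ⟨d.adj, h1, h2⟩, hz.pos _ _ ⟨d.adj.symm, h2, h1⟩⟩
    -- The value at `i` is the product of the ratios `z a b / z b a` along the chosen walk from `r`
    -- to `i`.
    refine ⟨fun i => Real.exp ((Q i).darts.map fun d => σ d.fst d.snd).sum, ?_, ?_⟩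
    · exact fun h0 => (Real.exp_pos _).ne' (congrFun h0 ⟨r, hr⟩)
    · intro i j hij
      have hpos := hz.pos i j ⟨hij, i.2, j.2⟩
      have hpos' := hz.pos j i ⟨hij.symm, j.2, i.2⟩
      -- The closed walk from `r` to `i`, across the edge to `j` and back to `r` compares the values
      -- at `i` and `j`.
      have key := BaryDrawing.sum_darts_eq_zero_of_faces hγ hσ hface
        ((Q i).append (.cons hij (Q j).reverse)) fun w hw => by
          rw [SimpleGraph.Walk.mem_support_append_iff, SimpleGraph.Walk.support_cons,
            List.mem_cons, SimpleGraph.Walk.support_reverse, List.mem_reverse] at hw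
          rcases hw with hw | rfl | hw
          · exact hQ i w hw
          · exact i.2
          · exact hQ j w hw
      rw [SimpleGraph.Walk.darts_append, List.map_append, List.sum_append,
        SimpleGraph.Walk.darts_cons, List.map_cons, List.sum_cons,
        BaryDrawing.sum_darts_reverse hσ] at key
      have e : ((Q j).darts.map fun d => σ d.fst d.snd).sum
          = ((Q i).darts.map fun d => σ d.fst d.snd).sum
            + (Real.log (z i j) - Real.log (z j i)) := by
        simp only [σ] at key ⊢
        linarith
      change Real.exp _ * _ - Real.exp _ * _ = 0
      rw [e, Real.exp_add, Real.exp_sub, Real.exp_log hpos, Real.exp_log hpos']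
      field_simp
      ring
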